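/- Let $K=\mathbb{Q}(\rho)$, where $\rho$ is a root of the polynomial $x^3-41x^2-44x-1$, and let $\mathcal{O}_K$ be its ring of integers. Put $g_1=1$, $g_2=\rho$, $g_3=\frac{4+3\rho+\rho^2}{7}$; these form an integral basis of $K$. An element of $K$ is totally positive if all its images under the embeddings $K\to\mathbb{R}$ are positive (the field $K$ is totally real). A totally positive $\alpha\in\mathcal{O}_K$ is indecomposable if it is not a sum of two totally positive elements of $\mathcal{O}_K$, and its minimal trace is the minimum of $\mathrm{Tr}(\delta\alpha)$ over all totally positive $\delta$ in the codifferent $\{\delta\in K : \mathrm{Tr}(\delta\beta)\in\mathbb{Z}\text{ for all }\beta\in\mathcal{O}_K\}$. Up to multiplication by totally positive units, the indecomposable elements of $\mathcal{O}_K$ are exactly the following ones ($v$ and $w$ are integers), and no two distinct elements of the list differ by multiplication by a totally positive unit. Of minimal trace $1$: the element $1$ and 1. $-(5v+2)g_1-wg_2+(7v+3)g_3$, where $0\leq v\leq 5$ and $46v+14\leq w\leq 45v+19$; 2. $-vg_2+g_3$, where $1\leq v\leq 6$; 3. $-g_1-vg_2+2g_3$, where $1\leq v\leq 12$; 4. $-(5v+125)g_1-(45v+1132)g_2+(7v+176)g_3$,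 where $0\leq v\leq 5$; 5. $-(5v+31)g_1-(45v+283)g_2+(7v+44)g_3$, where $0\leq v\leq 11$; 6. $-(5v+5)g_1-(46v+22)g_2+(7v+8)g_3$, where $0\leq v\leq 5$; 7. $-(5v+6)g_1-(46v+41)g_2+(7v+9)g_3$, where $0\leq v\leq 11$. Of minimal trace $2$: 8. $-3g_1-vg_2+5g_3$, where $9\leq v\leq 14$; 9. $-(5v+3)g_1-(45v+32)g_2+(7v+5)g_3$, where $0\leq v\leq 5$; 10. $-(5v+93)g_1-(46v+837)g_2+(7v+131)g_3$, where $0\leq v\leq 5$; 11. $-4g_1-4g_2+7g_3$, $-4g_1-45g_2+7g_3$ and $-209g_1-1890g_2+294g_3$. Of minimal trace $3$: 12. $-4g_1-vg_2+7g_3$, where $5\leq v\leq 9$; 13. $-(5v+4)g_1-(45v+45)g_2+(7v+7)g_3$, where $1\leq v\leq 5$; 14. $-(5v+184)g_1-(46v+1660)g_2+(7v+259)g_3$, where $0\leq v\leq 4$. -/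

import Mathlib

open scoped NumberField

noncomputable section

namespace SimplestCubic

variable {K : Type*} [Field K]

/-- An element `x` of a (totally real) number field is totally positive if its image under every
embedding of the field into `ℝ` is positive. -/
def IsTotallyPositive (x : K) : Prop :=
  ∀ σ : K →+* ℝ, 0 < σ x

/-- A totally positive integer of `K` is indecomposable if it is not a sum of two totally positive
integers of `K`. -/
def IsIndecomposable (α : K) : Prop :=
  IsIntegral ℤ α ∧ IsTotallyPositive α ∧
    ¬ ∃ β γ : K, IsIntegral ℤ β ∧ IsTotallyPositive β ∧
      IsIntegral ℤ γ ∧ IsTotallyPositive γ ∧ α = β + γ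

/-- `α` and `β` agree up to multiplication by a totally positive unit of `𝓞 K`. -/
def AssociatedByTPUnit (α β : K) : Prop :=
  ∃ u : (𝓞 K)ˣ, IsTotallyPositive ((u : 𝓞 K) : K) ∧ α = ((u : 𝓞 K) : K) * β

variable (K) in
/-- The codifferent: the dual of `𝓞 K` with respect to the trace form of `K / ℚ`. -/
def codifferent [NumberField K] : Submodule (𝓞 K) K :=
  Submodule.traceDual ℤ ℚ (1 : Submodule (𝓞 K) K)

theorem mem_codifferent [NumberField K] {δ : K} :
    δ ∈ codifferent K ↔ ∀ α : 𝓞 K, ∃ n : ℤ, Algebra.trace ℚ K (δ * (α : K)) = n := by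
  rw [codifferent, Submodule.mem_traceDual]
  constructor
  · intro h α
    obtain ⟨n, hn⟩ := h (α : K) (Submodule.mem_one.2 ⟨α, rfl⟩)
    exact ⟨n, by simpa [Algebra.traceForm_apply] using hn.symm⟩
  · intro h a ha
    obtain ⟨α, rfl⟩ := Submodule.mem_one.1 ha
    obtain ⟨n, hn⟩ := h α
    exact ⟨n, by simpa [Algebra.traceForm_apply] using hn.symm⟩

/-- `m` is the minimal trace of `α`: the minimum (attained) of `Tr (δ α)` over the totally positive
elements `δ` of the codifferent. -/
def HasMinimalTrace [NumberField K] (α : K) (m : ℕ) : Prop :=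
  IsLeast {t : ℚ | ∃ δ ∈ codifferent K, IsTotallyPositive δ ∧ t = Algebra.trace ℚ K (δ * α)} (m : ℚ)

/-- The third basis element `g₃ = (4 + 3ρ + ρ²) / 7` (with `g₁ = 1` and `g₂ = ρ`). -/
def g₃ (ρ : K) : K := (4 + 3 * ρ + ρ ^ 2) / 7

/-- The element `x g₁ + y g₂ + z g₃`. -/
def elt (ρ : K) (x y z : ℤ) : K := (x : K) + (y : K) * ρ + (z : K) * g₃ ρ

/-- The listed elements of minimal trace `1`. -/
def list₁ (ρ : K) : Set K :=
  {1}
  ∪ {α | ∃ v w : ℤ, 0 ≤ v ∧ v ≤ 5 ∧ 46 * v + 14 ≤ w ∧ w ≤ 45 * v + 19 ∧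
      α = elt ρ (-(5 * v + 2)) (-w) (7 * v + 3)}
  ∪ {α | ∃ v : ℤ, 1 ≤ v ∧ v ≤ 6 ∧ α = elt ρ 0 (-v) 1}
  ∪ {α | ∃ v : ℤ, 1 ≤ v ∧ v ≤ 12 ∧ α = elt ρ (-1) (-v) 2}
  ∪ {α | ∃ v : ℤ, 0 ≤ v ∧ v ≤ 5 ∧ α = elt ρ (-(5 * v + 125)) (-(45 * v + 1132)) (7 * v + 176)}
  ∪ {α | ∃ v : ℤ, 0 ≤ v ∧ v ≤ 11 ∧ α = elt ρ (-(5 * v + 31)) (-(45 * v + 283)) (7 * v + 44)}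
  ∪ {α | ∃ v : ℤ, 0 ≤ v ∧ v ≤ 5 ∧ α = elt ρ (-(5 * v + 5)) (-(46 * v + 22)) (7 * v + 8)}
  ∪ {α | ∃ v : ℤ, 0 ≤ v ∧ v ≤ 11 ∧ α = elt ρ (-(5 * v + 6)) (-(46 * v + 41)) (7 * v + 9)}

/-- The listed elements of minimal trace `2`. -/
def list₂ (ρ : K) : Set K :=
  {α | ∃ v : ℤ, 9 ≤ v ∧ v ≤ 14 ∧ α = elt ρ (-3) (-v) 5}
  ∪ {α | ∃ v : ℤ, 0 ≤ v ∧ v ≤ 5 ∧ α = elt ρ (-(5 * v + 3)) (-(45 * v + 32)) (7 * v + 5)}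
  ∪ {α | ∃ v : ℤ, 0 ≤ v ∧ v ≤ 5 ∧ α = elt ρ (-(5 * v + 93)) (-(46 * v + 837)) (7 * v + 131)}
  ∪ {elt ρ (-4) (-4) 7, elt ρ (-4) (-45) 7, elt ρ (-209) (-1890) 294}

/-- The listed elements of minimal trace `3`. -/
def list₃ (ρ : K) : Set K :=
  {α | ∃ v : ℤ, 5 ≤ v ∧ v ≤ 9 ∧ α = elt ρ (-4) (-v) 7}
  ∪ {α | ∃ v : ℤ, 1 ≤ v ∧ v ≤ 5 ∧ α = elt ρ (-(5 * v + 4)) (-(45 * v + 45)) (7 * v + 7)}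
  ∪ {α | ∃ v : ℤ, 0 ≤ v ∧ v ≤ 4 ∧ α = elt ρ (-(5 * v + 184)) (-(46 * v + 1660)) (7 * v + 259)}

end SimplestCubic

end

/-!
The cubic has three real roots, so an integer `x + y ρ + z g₃` is totally positive exactly when its
trace, the second symmetric function of its conjugates and its norm, three explicit forms in
`x, y, z`, are positive. The integral basis comes from the Gram matrix of the trace form together
with the total ramification of `7` and `37` (`isIntegral_iff_exists_elt`).

The indecomposables are read off from the convex hull of the totally positive integers in
`K ⊗ ℝ = ℝ³`. Up to totally positive units its boundary has eight faces: a lattice triangle of side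
`5`, three equivalent pentagons with `26` lattice points each, a unimodular triangle and three
triangles of index `13` without further lattice points. Each face is supported by the form
`α ↦ Tr (δ α) / d` for a totally positive `δ` in the codifferent, with `d = 1` except for the
triangles of index `13`, where `d = 13`. Given a totally positive integer `α`, choose a face and an
associate of `α` at which the normalised form is least (`exists_minimal_associate`). Comparison with
the adjacent faces shows that this associate lies in the cone over the chosen face, and there it is
a sum of listed elements and of their associates (`mem_listedMonoid_of_minimal`): over a face with
`d = 1` the lattice points of the face generate, and over a triangle of index `13` one adds two rows
of points (`index13_mem`). This needs no knowledge of the unit group: only three units and their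
inverses, which glue the faces, occur. Hence every indecomposable is associated to a listed element.

Conversely, a lattice point of a face with `d = 1` has minimal trace `1`, and so is indecomposable.
Over a triangle of index `13` the form of the face takes values at most `25` on the listed points,
whereas it is at least `13` on every totally positive integer, so they are indecomposable too
(`IsInnerTriangle.isIndecomposable_of_level`). Their minimal traces follow from the fact that an
element of the codifferent takes positive integral values at the three vertices
(`IsInnerTriangle.lower_bound`). Finally, two listed elements with a totally positive unit as
quotient have the same norm, and one of them times the complementary conjugates of the other is
divisible by this norm, which is excluded by computation (`coords_pairwise`).
-/

open scoped NumberField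

noncomputable section

namespace SimplestCubic

/-! ### The field, its trace and its real embeddings -/

section

open Polynomial

/-- The cubic is irreducible already modulo `2`. -/
theorem irreducible_cubic :
    Irreducible (X ^ 3 - C 41 * X ^ 2 - C 44 * X - C 1 : ℚ[X]) := by
  have hm : (X ^ 3 - C 41 * X ^ 2 - C 44 * X - C 1 : ℤ[X]).Monic := by monicity!
  have hm2 : (X ^ 3 - C 41 * X ^ 2 - C 44 * X - C 1 : (ZMod 2)[X]).Monic := by monicity!
  have hd : (X ^ 3 - C 41 * X ^ 2 - C 44 * X - C 1 : (ZMod 2)[X]).natDegree = 3 := by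
    compute_degree!
  have h : Irreducible (X ^ 3 - C 41 * X ^ 2 - C 44 * X - C 1 : ℤ[X]) := by
    refine hm.irreducible_of_irreducible_map (Int.castRingHom (ZMod 2)) _ ?_
    have e : (X ^ 3 - C 41 * X ^ 2 - C 44 * X - C 1 : ℤ[X]).map (Int.castRingHom (ZMod 2))
        = X ^ 3 - C 41 * X ^ 2 - C 44 * X - C 1 := by
      simp only [Polynomial.map_sub, Polynomial.map_mul, Polynomial.map_pow, map_X, map_C]
      rfl
    rw [e, hm2.irreducible_iff_roots_eq_zero_of_degree_le_three (by omega) (by omega)]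
    refine Multiset.eq_zero_of_forall_notMem fun x hx => ?_
    have hx' := (mem_roots'.1 hx).2
    simp only [IsRoot.def, eval_sub, eval_mul, eval_pow, eval_X, eval_C] at hx'
    clear hx
    revert x
    decide
  have h2 := (hm.irreducible_iff_irreducible_map_fraction_map (K := ℚ)).1 h
  simpa only [Polynomial.map_sub, Polynomial.map_mul, Polynomial.map_pow, map_X, map_C,
    show algebraMap ℤ ℚ 41 = 41 by simp, show algebraMap ℤ ℚ 44 = 44 by simp,
    show algebraMap ℤ ℚ 1 = 1 by simp] using h2

/-- The trace of `x + y ρ + z g₃`. -/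
def trForm {R : Type*} [CommRing R] (x y z : R) : R := 3 * x + 41 * y + 272 * z

/-- The second elementary symmetric function of the conjugates of `x + y ρ + z g₃`. -/
def symForm {R : Type*} [CommRing R] (x y z : R) : R :=
  3 * x ^ 2 - 44 * y ^ 2 + 229 * z ^ 2 + 82 * x * y + 544 * x * z - 249 * y * z

/-- The norm of `x + y ρ + z g₃`. -/
def normForm {R : Type*} [CommRing R] (x y z : R) : R :=
  x ^ 3 + 41 * x ^ 2 * y + 272 * x ^ 2 * z - 44 * x * y ^ 2 - 249 * x * y * z + 229 * x * z ^ 2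
    + y ^ 3 - 18 * y ^ 2 * z - 151 * y * z ^ 2 + 43 * z ^ 3

/-- The three forms are the elementary symmetric functions of the conjugates of `x + y ρ + z g₃`,
the conjugates of `ρ` being the roots `r, s, t` of the cubic. -/
theorem forms_of_roots {r s t : ℝ} (h₁ : r + s + t = 41) (h₂ : r * s + r * t + s * t = -44)
    (h₃ : r * s * t = 1) (x y z : ℝ) :
    trForm x y z = (x + y * r + z * g₃ r) + (x + y * s + z * g₃ s) + (x + y * t + z * g₃ t) ∧
    symForm x y z = (x + y * r + z * g₃ r) * (x + y * s + z * g₃ s)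
      + (x + y * r + z * g₃ r) * (x + y * t + z * g₃ t)
      + (x + y * s + z * g₃ s) * (x + y * t + z * g₃ t) ∧
    normForm x y z = (x + y * r + z * g₃ r) * (x + y * s + z * g₃ s) * (x + y * t + z * g₃ t) := by
  obtain rfl : r = 41 - s - t := by linarith
  simp only [trForm, symForm, normForm, g₃]
  have a1 : s ^ 2 = 41 * s - s * t + 41 * t - t ^ 2 + 44 := by linear_combination -h₂
  have a2 : t ^ 3 = 41 * t ^ 2 + 44 * t + 1 := by linear_combination h₃ - t * h₂
  refine ⟨?_, ?_, ?_⟩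
  · grind
  · grind
  · grind

variable {K : Type*} [Field K]

theorem map_g₃ {L : Type*} [Field L] (σ : K →+* L) (ρ : K) : σ (g₃ ρ) = g₃ (σ ρ) := by
  simp only [g₃, map_div₀, map_add, map_mul, map_pow, map_ofNat]

variable {ρ : K}

section CharZero

variable [CharZero K]

theorem minpoly_eq (hρ : ρ ^ 3 - 41 * ρ ^ 2 - 44 * ρ - 1 = 0) :
    minpoly ℚ ρ = X ^ 3 - C 41 * X ^ 2 - C 44 * X - C 1 := by
  refine (minpoly.eq_of_irreducible_of_monic irreducible_cubic ?_ (by monicity!)).symm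
  simpa using hρ

theorem natDegree_minpoly (hρ : ρ ^ 3 - 41 * ρ ^ 2 - 44 * ρ - 1 = 0) :
    (minpoly ℚ ρ).natDegree = 3 := by
  rw [minpoly_eq hρ]; compute_degree!

theorem coords_eq_zero (hρ : ρ ^ 3 - 41 * ρ ^ 2 - 44 * ρ - 1 = 0) {a b c : ℚ}
    (h : (a : K) + b * ρ + c * g₃ ρ = 0) : a = 0 ∧ b = 0 ∧ c = 0 := by
  set p : ℚ[X] := C (c / 7) * X ^ 2 + C (b + 3 * c / 7) * X + C (a + 4 * c / 7) with hp
  have hp0 : p = 0 := by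
    by_contra hne
    have h1 := natDegree_le_natDegree (minpoly.degree_le_of_ne_zero ℚ ρ hne (by
      simp only [hp, map_add, map_mul, aeval_C, aeval_X, map_pow, eq_ratCast]
      push_cast
      rw [← h, g₃]
      ring))
    have h2 : p.natDegree ≤ 2 := by rw [hp]; compute_degree
    rw [natDegree_minpoly hρ] at h1
    omega
  have h0 : p.coeff 0 = 0 := by simp [hp0]
  have h1 : p.coeff 1 = 0 := by simp [hp0]
  have h2 : p.coeff 2 = 0 := by simp [hp0]
  simp [hp, coeff_X, coeff_C] at h0 h1 h2
  subst h2
  exact ⟨by simpa using h0, by simpa using h1, rfl⟩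

theorem coords_mul_rho (hρ : ρ ^ 3 - 41 * ρ ^ 2 - 44 * ρ - 1 = 0) (a b c : ℚ) :
    ((a : K) + b * ρ + c * g₃ ρ) * ρ = ((-4 * b - 25 * c : ℚ) : K)
      + ((a - 3 * b - 12 * c : ℚ) : K) * ρ + ((7 * b + 44 * c : ℚ) : K) * g₃ ρ := by
  simp only [g₃]; push_cast
  linear_combination (c / 7 : K) * hρ

theorem coords_mul_g₃ (hρ : ρ ^ 3 - 41 * ρ ^ 2 - 44 * ρ - 1 = 0) (a b c : ℚ) :
    ((a : K) + b * ρ + c * g₃ ρ) * g₃ ρ = ((-25 * b - 161 * c : ℚ) : K)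
      + ((-12 * b - 79 * c : ℚ) : K) * ρ + ((a + 44 * b + 284 * c : ℚ) : K) * g₃ ρ := by
  simp only [g₃]; push_cast
  linear_combination (b / 7 + c * (ρ + 47) / 49 : K) * hρ

end CharZero

variable [NumberField K]

theorem adjoin_eq_top (hK : IntermediateField.adjoin ℚ {ρ} = (⊤ : IntermediateField ℚ K)) :
    Algebra.adjoin ℚ {ρ} = ⊤ := by
  rw [← IntermediateField.adjoin_simple_toSubalgebra_of_isAlgebraic
    (IsAlgebraic.of_finite ℚ ρ), hK, IntermediateField.top_toSubalgebra]

theorem exists_coords (hρ : ρ ^ 3 - 41 * ρ ^ 2 - 44 * ρ - 1 = 0)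
    (hK : IntermediateField.adjoin ℚ {ρ} = (⊤ : IntermediateField ℚ K)) (x : K) :
    ∃ a b c : ℚ, x = a + b * ρ + c * g₃ ρ := by
  have hx : x ∈ Algebra.adjoin ℚ {ρ} := by rw [adjoin_eq_top hK]; trivial
  rw [Algebra.adjoin_singleton_eq_range_aeval] at hx
  obtain ⟨p, rfl⟩ := hx
  set q : ℚ[X] := X ^ 3 - C 41 * X ^ 2 - C 44 * X - C 1 with hq
  have hqm : q.Monic := by rw [hq]; monicity!
  have hqd : q.natDegree = 3 := by rw [hq]; compute_degree!
  have hq0 : aeval ρ q = 0 := by simpa [hq] using hρ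
  have hr := aeval_modByMonic_eq_self_of_root (p := p) hq0
  have hd : (p %ₘ q).natDegree < 3 := by
    have := natDegree_modByMonic_lt p hqm (by intro h; rw [h] at hqd; simp at hqd)
    omega
  have he := congrArg (aeval ρ) (as_sum_range' (p %ₘ q) 3 hd)
  rw [hr] at he
  simp only [Finset.sum_range_succ, Finset.sum_range_zero, aeval_monomial, map_add, map_zero] at he
  set u := (p %ₘ q).coeff 0
  set v := (p %ₘ q).coeff 1
  set w := (p %ₘ q).coeff 2
  refine ⟨u - 4 * w, v - 3 * w, 7 * w, ?_⟩
  refine he.trans ?_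
  simp only [g₃, eq_ratCast]
  push_cast
  ring

/-- The basis `1, ρ, g₃` of `K` over `ℚ`. -/
def ratBasis (hρ : ρ ^ 3 - 41 * ρ ^ 2 - 44 * ρ - 1 = 0)
    (hK : IntermediateField.adjoin ℚ {ρ} = (⊤ : IntermediateField ℚ K)) :
    Module.Basis (Fin 3) ℚ K :=
  Module.Basis.mk (v := ![1, ρ, g₃ ρ])
    (by
      rw [Fintype.linearIndependent_iff]
      intro g hg
      simp only [Fin.sum_univ_three, Matrix.cons_val, Rat.smul_def, mul_one] at hg
      obtain ⟨h0, h1, h2⟩ := coords_eq_zero hρ hg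
      intro i
      fin_cases i <;> assumption)
    (by
      rintro x -
      obtain ⟨a, b, c, rfl⟩ := exists_coords hρ hK x
      rw [Submodule.mem_span_range_iff_exists_fun]
      exact ⟨![a, b, c], by simp [Fin.sum_univ_three, Rat.smul_def]⟩)

theorem ratBasis_repr (hρ : ρ ^ 3 - 41 * ρ ^ 2 - 44 * ρ - 1 = 0)
    (hK : IntermediateField.adjoin ℚ {ρ} = (⊤ : IntermediateField ℚ K)) (a b c : ℚ) :
    ((ratBasis hρ hK).repr (a + b * ρ + c * g₃ ρ) : Fin 3 → ℚ) = ![a, b, c] := by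
  have h : (a + b * ρ + c * g₃ ρ : K) = ∑ i, ![a, b, c] i • ratBasis hρ hK i := by
    simp [Fin.sum_univ_three, Rat.smul_def, ratBasis]
  rw [h, Module.Basis.repr_sum_self]

theorem trace_eq (hρ : ρ ^ 3 - 41 * ρ ^ 2 - 44 * ρ - 1 = 0)
    (hK : IntermediateField.adjoin ℚ {ρ} = (⊤ : IntermediateField ℚ K)) (a b c : ℚ) :
    Algebra.trace ℚ K (a + b * ρ + c * g₃ ρ) = trForm a b c := by
  rw [Algebra.trace_eq_matrix_trace (ratBasis hρ hK), Matrix.trace, Fin.sum_univ_three]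
  simp only [Matrix.diag_apply, Algebra.leftMulMatrix_eq_repr_mul]
  have b0 : ratBasis hρ hK 0 = 1 := by simp [ratBasis]
  have b1 : ratBasis hρ hK 1 = ρ := by simp [ratBasis]
  have b2 : ratBasis hρ hK 2 = g₃ ρ := by simp [ratBasis]
  rw [b0, b1, b2]
  rw [mul_one, coords_mul_rho hρ, coords_mul_g₃ hρ, ratBasis_repr, ratBasis_repr, ratBasis_repr]
  simp [trForm]; ring

/-- The field has exactly three embeddings into `ℝ`, one for each root of the cubic. -/
theorem exists_embeddings (hρ : ρ ^ 3 - 41 * ρ ^ 2 - 44 * ρ - 1 = 0)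
    (hK : IntermediateField.adjoin ℚ {ρ} = (⊤ : IntermediateField ℚ K)) :
    ∃ σ : Fin 3 → (K →+* ℝ), (∀ τ : K →+* ℝ, ∃ i, τ = σ i) ∧
      σ 0 ρ + σ 1 ρ + σ 2 ρ = 41 ∧ σ 0 ρ * σ 1 ρ + σ 0 ρ * σ 2 ρ + σ 1 ρ * σ 2 ρ = -44 ∧
      σ 0 ρ * σ 1 ρ * σ 2 ρ = 1 := by
  have hc : Continuous fun x : ℝ => x ^ 3 - 41 * x ^ 2 - 44 * x - 1 := by fun_prop
  -- The roots lie in `(42, 43)`, `(-2, -1)` and `(-1, 0)`.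
  obtain ⟨r, ⟨hr1, hr2⟩, hr⟩ := intermediate_value_Icc (by norm_num : (42 : ℝ) ≤ 43)
    hc.continuousOn (show (0 : ℝ) ∈ _ by norm_num)
  obtain ⟨s, ⟨hs1, hs2⟩, hs⟩ := intermediate_value_Icc (by norm_num : (-2 : ℝ) ≤ -1)
    hc.continuousOn (show (0 : ℝ) ∈ _ by norm_num)
  obtain ⟨t, ⟨ht1, ht2⟩, ht⟩ := intermediate_value_Icc' (by norm_num : (-1 : ℝ) ≤ 0)
    hc.continuousOn (show (0 : ℝ) ∈ _ by norm_num)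
  simp only at hr hs ht
  have hst : s ≠ t := by
    rintro rfl
    obtain rfl : s = -1 := le_antisymm hs2 ht1
    norm_num at hs
  have hrs : r ≠ s := by intro h; linarith
  have hrt : r ≠ t := by intro h; linarith
  -- Divided differences of the cubic at the distinct roots give the Vieta relations.
  have h1 : r ^ 2 + r * s + s ^ 2 - 41 * (r + s) - 44 = 0 :=
    mul_left_cancel₀ (sub_ne_zero.2 hrs) (by linear_combination hr - hs)
  have h2 : r ^ 2 + r * t + t ^ 2 - 41 * (r + t) - 44 = 0 :=
    mul_left_cancel₀ (sub_ne_zero.2 hrt) (by linear_combination hr - ht)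
  have h3 : r + s + t - 41 = 0 :=
    mul_left_cancel₀ (sub_ne_zero.2 hst) (by linear_combination h1 - h2)
  let pb := PowerBasis.ofAdjoinEqTop (Algebra.IsIntegral.isIntegral (R := ℚ) ρ) (adjoin_eq_top hK)
  have hgen : pb.gen = ρ := PowerBasis.ofAdjoinEqTop_gen _ _
  have hlift : ∀ x : ℝ, x ^ 3 - 41 * x ^ 2 - 44 * x - 1 = 0 → ∃ σ : K →+* ℝ, σ ρ = x := by
    intro x hx
    have h0 : aeval x (minpoly ℚ pb.gen) = 0 := by
      rw [hgen, minpoly_eq hρ]; simpa using hx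
    exact ⟨(pb.lift x h0).toRingHom, by simpa [hgen] using pb.lift_gen x h0⟩
  obtain ⟨σr, er⟩ := hlift r hr
  obtain ⟨σs, es⟩ := hlift s hs
  obtain ⟨σt, et⟩ := hlift t ht
  refine ⟨![σr, σs, σt], fun τ => ?_, ?_, ?_, ?_⟩
  · have hτ : (τ ρ - r) * (τ ρ - s) * (τ ρ - t) = 0 := by
      have := congrArg τ hρ
      simp only [map_sub, map_mul, map_pow, map_ofNat, map_one, map_zero] at this
      obtain rfl : t = 41 - r - s := by linarith
      linear_combination this + (r - τ ρ) * h1 - hr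
    have key : ∀ σ : K →+* ℝ, τ ρ = σ ρ → τ = σ := by
      intro σ h
      ext x
      obtain ⟨a, b, c, rfl⟩ := exists_coords hρ hK x
      simp [map_g₃, h]
    rcases mul_eq_zero.1 hτ with h | h
    · rcases mul_eq_zero.1 h with h | h
      · exact ⟨0, key _ (by simp [er]; linarith)⟩
      · exact ⟨1, key _ (by simp [es]; linarith)⟩
    · exact ⟨2, key _ (by simp [et]; linarith)⟩
  · simp [er, es, et]; linarith
  · simp [er, es, et]
    obtain rfl : t = 41 - r - s := by linarith
    linear_combination -h1
  · simp [er, es, et]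
    obtain rfl : t = 41 - r - s := by linarith
    linear_combination hr - r * h1

end

/-! ### Total positivity and the ring of integers -/

section

/-- The prime `7` is totally ramified. In the basis `1, g₃ - 2, ρ - 2`, whose elements have
valuations `0, 1, 2` at the prime above `7`, divisibility of the norm by `7`, `7 ^ 2`, `7 ^ 3` forces the
coordinates to be divisible by `7` one after the other. -/
theorem seven_dvd_of_normForm {A B C m : ℤ} (h : normForm A B C = 7 ^ 3 * m) :
    7 ∣ A ∧ 7 ∣ B ∧ 7 ∣ C := by
  have p7 : Prime (7 : ℤ) := by norm_num
  obtain ⟨u, hu⟩ : (7 : ℤ) ∣ A + 2 * B + 2 * C := by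
    refine p7.dvd_of_dvd_pow (n := 3) ?_
    obtain ⟨u, rfl⟩ : ∃ u, A = u - 2 * B - 2 * C := ⟨A + 2 * B + 2 * C, by ring⟩
    refine ⟨49 * m - (5 * u ^ 2 * B + 38 * u ^ 2 * C - 28 * u * B ^ 2 - 211 * u * B * C
      - 121 * u * C ^ 2 + 35 * B ^ 3 + 280 * B ^ 2 * C + 315 * B * C ^ 2 + 95 * C ^ 3), ?_⟩
    simp only [normForm] at h
    linear_combination h
  obtain rfl : A = 7 * u - 2 * B - 2 * C := by linear_combination hu
  obtain ⟨C, rfl⟩ : (7 : ℤ) ∣ C := by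
    have h1 : (7 : ℤ) ∣ 95 * C ^ 3 := by
      refine ⟨7 * m - (7 * u ^ 3 + 35 * u ^ 2 * B + 266 * u ^ 2 * C - 28 * u * B ^ 2
        - 211 * u * B * C - 121 * u * C ^ 2 + 5 * B ^ 3 + 40 * B ^ 2 * C + 45 * B * C ^ 2), ?_⟩
      simp only [normForm] at h
      linarith
    exact p7.dvd_of_dvd_pow ((p7.dvd_or_dvd h1).resolve_left (by norm_num))
  obtain ⟨B, rfl⟩ : (7 : ℤ) ∣ B := by
    have h1 : (7 : ℤ) ∣ 5 * B ^ 3 := by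
      refine ⟨m - (u ^ 3 + 5 * u ^ 2 * B + 266 * u ^ 2 * C - 4 * u * B ^ 2 - 211 * u * B * C
        - 847 * u * C ^ 2 + 40 * B ^ 2 * C + 315 * B * C ^ 2 + 665 * C ^ 3), ?_⟩
      simp only [normForm] at h
      linarith
    exact p7.dvd_of_dvd_pow ((p7.dvd_or_dvd h1).resolve_left (by norm_num))
  omega

/-- The prime `37` is totally ramified; the elements `1, ρ - 26, g₃ + 8 ρ + 22` have valuations
`0, 1, 2` at the prime above it. -/
theorem thirtySeven_dvd_of_normForm {A B C m : ℤ} (h : normForm A B C = 37 ^ 3 * m) :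
    37 ∣ A ∧ 37 ∣ B ∧ 37 ∣ C := by
  have p37 : Prime (37 : ℤ) := by norm_num
  obtain ⟨v, rfl⟩ : ∃ v, B = v + 8 * C := ⟨B - 8 * C, by ring⟩
  obtain ⟨u, hu⟩ : (37 : ℤ) ∣ A + 26 * v - 22 * C := by
    refine p37.dvd_of_dvd_pow (n := 3) ?_
    obtain ⟨u, rfl⟩ : ∃ u, A = u - 26 * v + 22 * C := ⟨A + 26 * v - 22 * C, by ring⟩
    refine ⟨37 ^ 2 * m - (-u ^ 2 * v + 18 * u ^ 2 * C - 4 * u * v ^ 2 - 913 * u * v * C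
      + 629 * u * C ^ 2 + 305 * v ^ 3 + 11544 * v ^ 2 * C - 16391 * v * C ^ 2
      + 5365 * C ^ 3), ?_⟩
    simp only [normForm] at h
    linear_combination h
  obtain rfl : A = 37 * u - 26 * v + 22 * C := by linear_combination hu
  obtain ⟨v, rfl⟩ : (37 : ℤ) ∣ v := by
    have h1 : (37 : ℤ) ∣ 305 * v ^ 3 := by
      refine ⟨37 * m - (37 * u ^ 3 - 37 * u ^ 2 * v + 666 * u ^ 2 * C - 4 * u * v ^ 2
        - 913 * u * v * C + 629 * u * C ^ 2 + 312 * v ^ 2 * C - 443 * v * C ^ 2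
        + 145 * C ^ 3), ?_⟩
      simp only [normForm] at h
      linarith
    exact p37.dvd_of_dvd_pow ((p37.dvd_or_dvd h1).resolve_left (by norm_num))
  obtain ⟨C, rfl⟩ : (37 : ℤ) ∣ C := by
    have h1 : (37 : ℤ) ∣ 145 * C ^ 3 := by
      refine ⟨m - (u ^ 3 - 37 * u ^ 2 * v + 18 * u ^ 2 * C - 148 * u * v ^ 2 - 913 * u * v * C
        + 17 * u * C ^ 2 + 11285 * v ^ 3 + 11544 * v ^ 2 * C - 443 * v * C ^ 2), ?_⟩
      simp only [normForm] at h
      linarith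
    exact p37.dvd_of_dvd_pow ((p37.dvd_or_dvd h1).resolve_left (by norm_num))
  omega

/-- A cubic with real roots and coefficients of alternating sign has only positive roots. -/
theorem pos_iff_symm_pos (u v w : ℝ) :
    (0 < u ∧ 0 < v ∧ 0 < w) ↔
      0 < u + v + w ∧ 0 < u * v + u * w + v * w ∧ 0 < u * v * w := by
  constructor
  · rintro ⟨hu, hv, hw⟩
    exact ⟨by positivity, by positivity, by positivity⟩
  · rintro ⟨h1, h2, h3⟩
    have key : ∀ a, (a - u) * (a - v) * (a - w) = 0 → 0 < a := by
      intro a ha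
      by_contra! hle
      have e : a ^ 3 - (u + v + w) * a ^ 2 + (u * v + u * w + v * w) * a - u * v * w = 0 := by
        linear_combination ha
      have a3 : a ^ 3 ≤ 0 := by
        have : a ^ 3 = a * a ^ 2 := by ring
        rw [this]; exact mul_nonpos_of_nonpos_of_nonneg hle (sq_nonneg a)
      have a2 := mul_nonneg h1.le (sq_nonneg a)
      have a1 := mul_nonpos_of_nonneg_of_nonpos h2.le hle
      linarith
    exact ⟨key u (by ring), key v (by ring), key w (by ring)⟩

variable {K : Type*} [Field K] {ρ : K}

theorem IsTotallyPositive.add {x y : K} (hx : IsTotallyPositive x) (hy : IsTotallyPositive y) :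
    IsTotallyPositive (x + y) := fun σ => by
  rw [map_add]; exact add_pos (hx σ) (hy σ)

theorem IsTotallyPositive.mul {x y : K} (hx : IsTotallyPositive x) (hy : IsTotallyPositive y) :
    IsTotallyPositive (x * y) := fun σ => by
  rw [map_mul]; exact mul_pos (hx σ) (hy σ)

theorem elt_add (ρ : K) (x y z x' y' z' : ℤ) :
    elt ρ x y z + elt ρ x' y' z' = elt ρ (x + x') (y + y') (z + z') := by
  simp only [elt]; push_cast; ring

theorem elt_eq_rat (ρ : K) (x y z : ℤ) :
    elt ρ x y z = ((x : ℚ) : K) + ((y : ℚ) : K) * ρ + ((z : ℚ) : K) * g₃ ρ := by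
  simp [elt]

section CharZero

variable [CharZero K]

theorem elt_mul (hρ : ρ ^ 3 - 41 * ρ ^ 2 - 44 * ρ - 1 = 0) (x y z p q r : ℤ) :
    elt ρ x y z * elt ρ p q r =
      elt ρ (x * p - 4 * (y * q) - 25 * (y * r + z * q) - 161 * (z * r))
        (x * q + y * p - 3 * (y * q) - 12 * (y * r + z * q) - 79 * (z * r))
        (x * r + z * p + 7 * (y * q) + 44 * (y * r + z * q) + 284 * (z * r)) := by
  simp only [elt, g₃]; push_cast
  linear_combination ((y * r + z * q) / 7 + z * r * (ρ + 47) / 49 : K) * hρ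

theorem isIntegral_elt (hρ : ρ ^ 3 - 41 * ρ ^ 2 - 44 * ρ - 1 = 0) (x y z : ℤ) :
    IsIntegral ℤ (elt ρ x y z) := by
  have h1 : IsIntegral ℤ ρ := by
    refine ⟨Polynomial.X ^ 3 - 41 * Polynomial.X ^ 2 - 44 * Polynomial.X - 1, ?_, ?_⟩
    · have : (Polynomial.X ^ 3 - Polynomial.C 41 * Polynomial.X ^ 2 - Polynomial.C 44 *
        Polynomial.X - Polynomial.C 1 : Polynomial ℤ).Monic := by monicity!
      simpa using this
    · simpa using hρ
  have h2 : IsIntegral ℤ (g₃ ρ) := by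
    refine ⟨Polynomial.X ^ 3 - 272 * Polynomial.X ^ 2 + 229 * Polynomial.X - 43, ?_, ?_⟩
    · have : (Polynomial.X ^ 3 - Polynomial.C 272 * Polynomial.X ^ 2 + Polynomial.C 229 *
        Polynomial.X - Polynomial.C 43 : Polynomial ℤ).Monic := by monicity!
      simpa using this
    · simp [g₃]
      grind
  have hi : ∀ n : ℤ, IsIntegral ℤ (n : K) := fun n => isIntegral_algebraMap (x := n)
  exact ((hi x).add ((hi y).mul h1)).add ((hi z).mul h2)

theorem elt_inj (hρ : ρ ^ 3 - 41 * ρ ^ 2 - 44 * ρ - 1 = 0) {x y z x' y' z' : ℤ}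
    (h : elt ρ x y z = elt ρ x' y' z') : x = x' ∧ y = y' ∧ z = z' := by
  obtain ⟨h0, h1, h2⟩ := coords_eq_zero hρ (K := K) (a := x - x') (b := y - y') (c := z - z') (by
    simp only [elt] at h; push_cast; linear_combination h)
  refine ⟨?_, ?_, ?_⟩ <;> rw [sub_eq_zero] at h0 h1 h2 <;> assumption_mod_cast

end CharZero

variable [NumberField K]

theorem isTotallyPositive_iff (hρ : ρ ^ 3 - 41 * ρ ^ 2 - 44 * ρ - 1 = 0)
    (hK : IntermediateField.adjoin ℚ {ρ} = (⊤ : IntermediateField ℚ K)) (a b c : ℚ) :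
    IsTotallyPositive ((a : K) + b * ρ + c * g₃ ρ) ↔
      0 < trForm a b c ∧ 0 < symForm a b c ∧ 0 < normForm a b c := by
  obtain ⟨σ, hσ, h1, h2, h3⟩ := exists_embeddings hρ hK
  obtain ⟨f1, f2, f3⟩ := forms_of_roots h1 h2 h3 a b c
  have hs : IsTotallyPositive ((a : K) + b * ρ + c * g₃ ρ) ↔ 0 < a + b * σ 0 ρ + c * g₃ (σ 0 ρ) ∧
      0 < a + b * σ 1 ρ + c * g₃ (σ 1 ρ) ∧ 0 < a + b * σ 2 ρ + c * g₃ (σ 2 ρ) := by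
    have e : ∀ τ : K →+* ℝ, τ ((a : K) + b * ρ + c * g₃ ρ) = a + b * τ ρ + c * g₃ (τ ρ) := by
      intro τ; simp [map_g₃]
    constructor
    · intro h
      exact ⟨e (σ 0) ▸ h (σ 0), e (σ 1) ▸ h (σ 1), e (σ 2) ▸ h (σ 2)⟩
    · rintro ⟨p0, p1, p2⟩ τ
      obtain ⟨i, rfl⟩ := hσ τ
      rw [e]
      fin_cases i
      exacts [p0, p1, p2]
  rw [hs, pos_iff_symm_pos, ← f1, ← f2, ← f3]
  simp only [trForm, symForm, normForm]
  norm_cast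

theorem IsTotallyPositive.trace_pos (hρ : ρ ^ 3 - 41 * ρ ^ 2 - 44 * ρ - 1 = 0)
    (hK : IntermediateField.adjoin ℚ {ρ} = (⊤ : IntermediateField ℚ K)) {x : K}
    (hx : IsTotallyPositive x) : 0 < Algebra.trace ℚ K x := by
  obtain ⟨a, b, c, rfl⟩ := exists_coords hρ hK x
  rw [trace_eq hρ hK]
  exact ((isTotallyPositive_iff hρ hK a b c).1 hx).1

theorem isTotallyPositive_elt_iff (hρ : ρ ^ 3 - 41 * ρ ^ 2 - 44 * ρ - 1 = 0)
    (hK : IntermediateField.adjoin ℚ {ρ} = (⊤ : IntermediateField ℚ K)) (x y z : ℤ) :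
    IsTotallyPositive (elt ρ x y z) ↔
      0 < trForm x y z ∧ 0 < symForm x y z ∧ 0 < normForm x y z := by
  rw [elt_eq_rat, isTotallyPositive_iff hρ hK]
  simp only [trForm, symForm, normForm]
  norm_cast

theorem trace_elt (hρ : ρ ^ 3 - 41 * ρ ^ 2 - 44 * ρ - 1 = 0)
    (hK : IntermediateField.adjoin ℚ {ρ} = (⊤ : IntermediateField ℚ K)) (x y z : ℤ) :
    Algebra.trace ℚ K (elt ρ x y z) = (trForm x y z : ℤ) := by
  rw [elt_eq_rat, trace_eq hρ hK]
  simp [trForm]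

theorem exists_int_of_trace (hρ : ρ ^ 3 - 41 * ρ ^ 2 - 44 * ρ - 1 = 0)
    (hK : IntermediateField.adjoin ℚ {ρ} = (⊤ : IntermediateField ℚ K)) {a b c : ℚ}
    (h : IsIntegral ℤ ((a : K) + b * ρ + c * g₃ ρ)) : ∃ n : ℤ, trForm a b c = n := by
  have := Algebra.isIntegral_trace (L := ℚ) h
  rw [trace_eq hρ hK, IsIntegrallyClosed.isIntegral_iff] at this
  obtain ⟨n, hn⟩ := this
  exact ⟨n, by simpa using hn.symm⟩

theorem exists_int_of_norm (hρ : ρ ^ 3 - 41 * ρ ^ 2 - 44 * ρ - 1 = 0)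
    (hK : IntermediateField.adjoin ℚ {ρ} = (⊤ : IntermediateField ℚ K)) {a b c : ℚ}
    (h : IsIntegral ℤ ((a : K) + b * ρ + c * g₃ ρ)) : ∃ n : ℤ, normForm a b c = n := by
  obtain ⟨σ, -, h1, h2, h3⟩ := exists_embeddings hρ hK
  obtain ⟨-, -, f3⟩ := forms_of_roots h1 h2 h3 a b c
  have e : ∀ τ : K →+* ℝ, IsIntegral ℤ (a + b * τ ρ + c * g₃ (τ ρ)) := by
    intro τ
    have := h.map τ.toIntAlgHom
    simpa [map_g₃] using this
  have hi := ((e (σ 0)).mul (e (σ 1))).mul (e (σ 2))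
  rw [← f3, show normForm (a : ℝ) b c = algebraMap ℚ ℝ (normForm a b c) by simp [normForm],
    isIntegral_algebraMap_iff (algebraMap ℚ ℝ).injective, IsIntegrallyClosed.isIntegral_iff] at hi
  obtain ⟨n, hn⟩ := hi
  exact ⟨n, by simpa using hn.symm⟩

/-- The elements `1, ρ, g₃` are an integral basis. The traces of `x`, `ρ x` and `g₃ x` show that
`259 x` has integral coordinates when `x` is integral (`259` times the inverse of the Gram matrix of
the trace form is integral), and then the norm shows that these coordinates are divisible by the
totally ramified primes `7` and `37`. -/
theorem isIntegral_iff_exists_elt (hρ : ρ ^ 3 - 41 * ρ ^ 2 - 44 * ρ - 1 = 0)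
    (hK : IntermediateField.adjoin ℚ {ρ} = (⊤ : IntermediateField ℚ K)) {α : K} :
    IsIntegral ℤ α ↔ ∃ x y z : ℤ, α = elt ρ x y z := by
  constructor
  swap
  · rintro ⟨x, y, z, rfl⟩
    exact isIntegral_elt hρ x y z
  intro h
  obtain ⟨a, b, c, rfl⟩ := exists_coords hρ hK α
  have i1 : IsIntegral ℤ ρ := by simpa [elt] using isIntegral_elt hρ 0 1 0
  have i2 : IsIntegral ℤ (g₃ ρ) := by simpa [elt] using isIntegral_elt hρ 0 0 1
  obtain ⟨n₀, hn₀⟩ := exists_int_of_trace hρ hK h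
  obtain ⟨n₁, hn₁⟩ := exists_int_of_trace hρ hK (coords_mul_rho hρ a b c ▸ h.mul i1)
  obtain ⟨n₂, hn₂⟩ := exists_int_of_trace hρ hK (coords_mul_g₃ hρ a b c ▸ h.mul i2)
  obtain ⟨m, hm⟩ := exists_int_of_norm hρ hK h
  simp only [trForm] at hn₀ hn₁ hn₂
  -- The coefficients are the rows of `259` times the inverse Gram matrix.
  obtain ⟨A, hA⟩ : ∃ A : ℤ, a = A / 259 :=
    ⟨327 * n₀ + 334 * n₁ - 53 * n₂, by push_cast; linarith⟩
  obtain ⟨B, hB⟩ : ∃ B : ℤ, b = B / 259 :=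
    ⟨334 * n₀ + 566 * n₁ - 89 * n₂, by push_cast; linarith⟩
  obtain ⟨C, hC⟩ : ∃ C : ℤ, c = C / 259 :=
    ⟨-53 * n₀ - 89 * n₁ + 14 * n₂, by push_cast; linarith⟩
  have hN : normForm A B C = 259 ^ 3 * m := by
    have : ((normForm A B C : ℤ) : ℚ) = ((259 ^ 3 * m : ℤ) : ℚ) := by
      push_cast
      rw [← hm, hA, hB, hC]
      simp only [normForm]; push_cast; ring
    exact_mod_cast this
  obtain ⟨a7, b7, c7⟩ := seven_dvd_of_normForm (m := 37 ^ 3 * m) (by rw [hN]; ring)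
  obtain ⟨a37, b37, c37⟩ := thirtySeven_dvd_of_normForm (m := 7 ^ 3 * m) (by rw [hN]; ring)
  obtain ⟨x, rfl⟩ : (259 : ℤ) ∣ A := by omega
  obtain ⟨y, rfl⟩ : (259 : ℤ) ∣ B := by omega
  obtain ⟨z, rfl⟩ : (259 : ℤ) ∣ C := by omega
  refine ⟨x, y, z, ?_⟩
  rw [elt_eq_rat, hA, hB, hC]
  push_cast
  congr 2 <;> [congr 1; congr 1; skip] <;> field_simp

theorem exists_integralBasis (hρ : ρ ^ 3 - 41 * ρ ^ 2 - 44 * ρ - 1 = 0)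
    (hK : IntermediateField.adjoin ℚ {ρ} = (⊤ : IntermediateField ℚ K)) :
    ∃ b : Module.Basis (Fin 3) ℤ (𝓞 K),
      (b 0 : K) = 1 ∧ (b 1 : K) = ρ ∧ (b 2 : K) = g₃ ρ := by
  have i1 : IsIntegral ℤ ρ := by simpa [elt] using isIntegral_elt hρ 0 1 0
  have i2 : IsIntegral ℤ (g₃ ρ) := by simpa [elt] using isIntegral_elt hρ 0 0 1
  let v : Fin 3 → 𝓞 K := ![1, ⟨ρ, i1⟩, ⟨g₃ ρ, i2⟩]
  have hv : ∀ g : Fin 3 → ℤ, ((∑ i, g i • v i : 𝓞 K) : K) = elt ρ (g 0) (g 1) (g 2) := by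
    intro g
    simp [Fin.sum_univ_three, v, elt]
    rfl
  refine ⟨Module.Basis.mk (v := v) ?_ ?_, ?_, ?_, ?_⟩
  · rw [Fintype.linearIndependent_iff]
    intro g hg
    have h := hv g
    rw [hg] at h
    obtain ⟨h0, h1, h2⟩ := elt_inj hρ (x' := 0) (y' := 0) (z' := 0) (h.symm.trans (by simp [elt]))
    intro i
    fin_cases i <;> assumption
  · rintro x -
    obtain ⟨a, b, c, h⟩ := (isIntegral_iff_exists_elt hρ hK).1 x.2
    rw [Submodule.mem_span_range_iff_exists_fun]
    exact ⟨![a, b, c], by ext; rw [hv]; exact h.symm⟩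
  · simp [v]
  · simp [v]; rfl
  · simp [v]; rfl

end

/-! ### Lattice points of cones over lattice polygons -/

section

variable {M : Type*} [AddCommGroup M] {P : AddSubmonoid M}

theorem zsmul_mem_of_nonneg {a : M} (ha : a ∈ P) {n : ℤ} (hn : 0 ≤ n) : n • a ∈ P := by
  lift n to ℕ using hn
  rw [natCast_zsmul]
  exact P.nsmul_mem ha n

theorem row_mem {a d : M} {lo hi : ℤ} (h : ∀ k, lo ≤ k → k ≤ hi → a + k • d ∈ P) (s : ℕ) :
    ∀ k : ℤ, s * lo ≤ k → k ≤ s * hi → (s : ℤ) • a + k • d ∈ P := by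
  induction s with
  | zero =>
    intro k h1 h2
    obtain rfl : k = 0 := by push_cast at h1 h2; omega
    simp
  | succ s ih =>
    intro k h1 h2
    push_cast at h1 h2
    have hle : lo ≤ hi := by
      by_contra! hlt
      nlinarith
    have hs : s * lo ≤ s * hi := by gcongr
    obtain ⟨j, j1, j2, j3, j4⟩ : ∃ j, lo ≤ j ∧ j ≤ hi ∧ s * lo ≤ k - j ∧ k - j ≤ s * hi := by
      rcases le_total lo (k - s * hi) with hc | hc
      · exact ⟨k - s * hi, hc, by linarith, by linarith, by linarith⟩
      · exact ⟨lo, le_rfl, hle, by linarith, by linarith⟩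
    have e : ((s + 1 : ℕ) : ℤ) • a + k • d = (a + j • d) + ((s : ℤ) • a + (k - j) • d) := by
      push_cast; module
    rw [e]
    exact P.add_mem (h j j1 j2) (ih _ j3 j4)

/-- The lattice points of the cone over the convex hull of two parallel rows of lattice points, at
lattice distance one from each other, are sums of points of the rows. -/
theorem strip_mem {a b d : M} {lo hi lo' hi' : ℤ}
    (h : ∀ k, lo ≤ k → k ≤ hi → a + k • d ∈ P) (h' : ∀ k, lo' ≤ k → k ≤ hi' → b + k • d ∈ P)
    (hle : lo ≤ hi) (hle' : lo' ≤ hi') {s t k : ℤ} (hs : 0 ≤ s) (ht : 0 ≤ t)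
    (h1 : s * lo + t * lo' ≤ k) (h2 : k ≤ s * hi + t * hi') : s • a + t • b + k • d ∈ P := by
  lift s to ℕ using hs
  lift t to ℕ using ht
  have e1 : (s : ℤ) * lo ≤ s * hi := by gcongr
  have e2 : (t : ℤ) * lo' ≤ t * hi' := by gcongr
  obtain ⟨j, j1, j2, j3, j4⟩ :
      ∃ j, s * lo ≤ j ∧ j ≤ s * hi ∧ t * lo' ≤ k - j ∧ k - j ≤ t * hi' := by
    rcases le_total (s * lo) (k - t * hi') with hc | hc
    · exact ⟨k - t * hi', hc, by linarith, by linarith, by linarith⟩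
    · exact ⟨s * lo, le_rfl, e1, by linarith, by linarith⟩
  have e : (s : ℤ) • a + (t : ℤ) • b + k • d
      = ((s : ℤ) • a + j • d) + ((t : ℤ) • b + (k - j) • d) := by module
  rw [e]
  exact P.add_mem (row_mem h s j j1 j2) (row_mem h' t _ j3 j4)

theorem single_row {a d : M} (ha : a ∈ P) : ∀ k : ℤ, 0 ≤ k → k ≤ 0 → a + k • d ∈ P := by
  intro k h1 h2
  obtain rfl : k = 0 := by omega
  simpa using ha

/-- Lattice points of the cone over a triangle that is five times a unimodular one. -/
theorem triangle_mem {b f h : M}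
    (hb : ∀ i j : ℤ, 0 ≤ i → 0 ≤ j → i + j ≤ 5 → b + i • f + j • h ∈ P) {n i j : ℤ}
    (hi : 0 ≤ i) (hj : 0 ≤ j) (hij : i + j ≤ 5 * n) : n • b + i • f + j • h ∈ P := by
  have hn : 0 ≤ n := by omega
  lift n to ℕ using hn
  induction n generalizing i j with
  | zero =>
    obtain rfl : i = 0 := by push_cast at hij; omega
    obtain rfl : j = 0 := by push_cast at hij; omega
    simp
  | succ n ih =>
    push_cast at hij
    obtain ⟨i', j', hi', hj', h5, k1, k2, k3⟩ : ∃ i' j' : ℤ, 0 ≤ i' ∧ 0 ≤ j' ∧ i' + j' ≤ 5 ∧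
        0 ≤ i - i' ∧ 0 ≤ j - j' ∧ (i - i') + (j - j') ≤ 5 * n :=
      ⟨min i 5, min j (5 - min i 5), by omega, by omega, by omega, by omega, by omega, by omega⟩
    have e : ((n + 1 : ℕ) : ℤ) • b + i • f + j • h
        = (b + i' • f + j' • h) + ((n : ℤ) • b + (i - i') • f + (j - j') • h) := by
      push_cast; module
    rw [e]
    exact P.add_mem (hb i' j' hi' hj' h5) (ih k1 k2 k3)

/-- Lattice points of the cone over the lattice pentagon with vertices
`(0, 0), (1, 0), (2, -1), (3, -14), (3, -19)`. Apart from the rows in the direction of `d`, two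
unimodular triangles along the edge from `(0, 0)` to `(3, -19)` are needed. -/
theorem pentagon_mem {e s d : M} (h0 : e ∈ P)
    (h1 : ∀ k : ℤ, -6 ≤ k → k ≤ 0 → (e + s) + k • d ∈ P)
    (h2 : ∀ k : ℤ, -12 ≤ k → k ≤ -1 → (e + (2 : ℤ) • s) + k • d ∈ P)
    (h3 : ∀ k : ℤ, -19 ≤ k → k ≤ -14 → (e + (3 : ℤ) • s) + k • d ∈ P) {n i k : ℤ}
    (k1 : k ≤ 0) (k2 : k ≤ n - i) (k3 : k ≤ 25 * n - 13 * i) (k4 : i ≤ 3 * n)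
    (k5 : -19 * i ≤ 3 * k) : n • e + i • s + k • d ∈ P := by
  have strip23 : 2 * n ≤ i → 2 * n - 7 * i ≤ k → n • e + i • s + k • d ∈ P := by
    intro c1 c2
    have := strip_mem h2 h3 (by norm_num) (by norm_num) (s := 3 * n - i) (t := i - 2 * n) (k := k)
      (by omega) (by omega) (by omega) (by omega)
    convert this using 1
    module
  rcases le_or_gt (-6 * i) k with hr | hr
  · rcases le_or_gt i n with hi | hi
    · have := strip_mem (single_row (d := d) h0) h1 (by norm_num) (by norm_num) (s := n - i)
        (t := i) (k := k) (by omega) (by omega) (by omega) (by omega)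
      convert this using 1
      module
    · rcases le_or_gt i (2 * n) with hi' | hi'
      · have := strip_mem h1 h2 (by norm_num) (by norm_num) (s := 2 * n - i) (t := i - n) (k := k)
          (by omega) (by omega) (by omega) (by omega)
        convert this using 1
        module
      · exact strip23 (by omega) (by omega)
  · have m1 := h1 (-6) (by norm_num) (by norm_num)
    have m2 := h2 (-12) (by norm_num) (by norm_num)
    have m3 := h3 (-19) (by norm_num) (by norm_num)
    rcases le_or_gt 0 (n - 13 * i - 2 * k) with hp | hp
    · have := P.add_mem (P.add_mem (zsmul_mem_of_nonneg h0 hp)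
        (zsmul_mem_of_nonneg m1 (n := 19 * i + 3 * k) (by omega)))
        (zsmul_mem_of_nonneg m3 (n := -(k + 6 * i)) (by omega))
      convert this using 1
      module
    · rcases le_or_gt 0 (2 * n - 7 * i - k) with hq | hq
      · have := P.add_mem (P.add_mem (zsmul_mem_of_nonneg m1 hq)
          (zsmul_mem_of_nonneg m2 (n := 13 * i - n + 2 * k) (by omega)))
          (zsmul_mem_of_nonneg m3 (n := -(k + 6 * i)) (by omega))
        convert this using 1
        module
      · exact strip23 (by omega) (by omega)

/-- Lattice points of the cone over a lattice triangle of index `13` with vertices `V`,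
`2 R - d - V` and `V - R + 7 d`, where `V, R, d` is a basis of the lattice: besides the vertices,
the points `R + k d` and `V + k d` generate. -/
theorem index13_mem {V R d : M} (hV : ∀ k : ℤ, 0 ≤ k → k ≤ 6 → V + k • d ∈ P)
    (hR : ∀ k : ℤ, 0 ≤ k → k ≤ 5 → R + k • d ∈ P) (hC : (2 : ℤ) • R - d - V ∈ P)
    (hW : V - R + (7 : ℤ) • d ∈ P) {p q r : ℤ} (k1 : 0 ≤ 7 * q + r) (k2 : 0 ≤ q + 2 * r)
    (k3 : 0 ≤ 13 * p + 6 * q - r) : p • V + q • R + r • d ∈ P := by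
  -- The rows extend to the opposite edges of the cone by sums of vertices and row points.
  have hR' : ∀ k : ℤ, 0 ≤ k → k ≤ 6 → R + k • d ∈ P := by
    intro k a1 a2
    rcases Int.le_iff_lt_or_eq.1 a2 with a | rfl
    · exact hR k a1 (by omega)
    · convert P.add_mem hC hW using 1
      module
  have hV' : ∀ k : ℤ, 0 ≤ k → k ≤ 13 → V + k • d ∈ P := by
    intro k a1 a2
    rcases le_or_gt k 6 with a | a
    · exact hV k a1 a
    · convert P.add_mem hW (hR' (k - 7) (by omega) (by omega)) using 1
      module
  -- The cone over `C`, `V`, `R`, where `C = 2 R - d - V`, is unimodular; the rest of the cone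
  -- consists of three strips.
  by_cases hb : 0 ≤ p - r ∧ r ≤ 0
  · have := P.add_mem (P.add_mem (zsmul_mem_of_nonneg hC (n := -r) (by omega))
      (zsmul_mem_of_nonneg (hV 0 le_rfl (by norm_num)) hb.1))
      (zsmul_mem_of_nonneg (hR 0 le_rfl (by norm_num)) k2)
    convert this using 1
    module
  · rcases le_or_gt p 0 with hp | hp
    · have := strip_mem (single_row (d := d) hC) hR' (by norm_num) (by norm_num) (s := -p)
        (t := q + 2 * p) (k := r - p) (by omega) (by omega) (by omega) (by omega)
      convert this using 1
      module
    · rcases le_or_gt 0 q with hq | hq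
      · have := strip_mem hR' hV' (by norm_num) (by norm_num) (s := q) (t := p) (k := r)
          (by omega) (by omega) (by omega) (by omega)
        convert this using 1
        module
      · have := strip_mem (single_row (d := d) hW) hV' (by norm_num) (by norm_num) (s := -q)
          (t := p + q) (k := r + 7 * q) (by omega) (by omega) (by omega) (by omega)
        convert this using 1
        module

end

/-! ### Totally positive units and the codifferent -/

section

section Units

variable {K : Type*} [Field K]

theorem AssociatedByTPUnit.refl (α : K) : AssociatedByTPUnit α α :=
  ⟨1, fun σ => by simp, by simp⟩

theorem AssociatedByTPUnit.trans {α β γ : K} (h : AssociatedByTPUnit α β)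
    (h' : AssociatedByTPUnit β γ) : AssociatedByTPUnit α γ := by
  obtain ⟨u, hu, rfl⟩ := h
  obtain ⟨v, hv, rfl⟩ := h'
  exact ⟨u * v, by simpa using hu.mul hv, by simp [mul_assoc]⟩

theorem AssociatedByTPUnit.symm {α β : K} (h : AssociatedByTPUnit α β) :
    AssociatedByTPUnit β α := by
  obtain ⟨u, hu, rfl⟩ := h
  have e : (((u⁻¹ : (𝓞 K)ˣ) : 𝓞 K) : K) * ((u : 𝓞 K) : K) = 1 := by
    rw [← map_mul, Units.inv_mul, map_one]
  refine ⟨u⁻¹, fun σ => ?_, ?_⟩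
  · have h1 := congrArg σ e
    rw [map_mul, map_one] at h1
    exact pos_of_mul_pos_left (h1 ▸ one_pos) (hu σ).le
  · rw [← mul_assoc, e, one_mul]

theorem AssociatedByTPUnit.isTotallyPositive {α β : K} (h : AssociatedByTPUnit α β)
    (hβ : IsTotallyPositive β) : IsTotallyPositive α := by
  obtain ⟨u, hu, rfl⟩ := h
  exact hu.mul hβ

theorem AssociatedByTPUnit.isIntegral {α β : K} (h : AssociatedByTPUnit α β)
    (hβ : IsIntegral ℤ β) : IsIntegral ℤ α := by
  obtain ⟨u, hu, rfl⟩ := h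
  exact (u : 𝓞 K).2.mul hβ

theorem associatedByTPUnit_mul {u v : K} (hu : IsIntegral ℤ u) (hv : IsIntegral ℤ v)
    (huv : u * v = 1) (hp : IsTotallyPositive u) (α : K) : AssociatedByTPUnit (u * α) α :=
  ⟨⟨⟨u, hu⟩, ⟨v, hv⟩, by ext; exact huv, by ext; exact (mul_comm v u).trans huv⟩, hp, rfl⟩

theorem AssociatedByTPUnit.isIndecomposable {α β : K} (h : AssociatedByTPUnit α β)
    (hβ : IsIndecomposable β) : IsIndecomposable α := by
  refine ⟨h.isIntegral hβ.1, h.isTotallyPositive hβ.2.1, ?_⟩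
  rintro ⟨γ, δ, hγ, hγ', hδ, hδ', rfl⟩
  obtain ⟨u, hu, e⟩ := h.symm
  have hm : ∀ x : K, AssociatedByTPUnit (((u : 𝓞 K) : K) * x) x := fun x => ⟨u, hu, rfl⟩
  exact hβ.2.2 ⟨_, _, (hm γ).isIntegral hγ, (hm γ).isTotallyPositive hγ', (hm δ).isIntegral hδ,
    (hm δ).isTotallyPositive hδ', by rw [e, mul_add]⟩

end Units

variable {K : Type*} [Field K] {ρ : K}

theorem zsmul_elt (ρ : K) (n x y z : ℤ) : n • elt ρ x y z = elt ρ (n * x) (n * y) (n * z) := by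
  simp only [elt, zsmul_eq_mul]; push_cast; ring

theorem elt_sub (ρ : K) (x y z x' y' z' : ℤ) :
    elt ρ x y z - elt ρ x' y' z' = elt ρ (x - x') (y - y') (z - z') := by
  simp only [elt]; push_cast; ring

theorem elt_congr {x y z x' y' z' : ℤ} (hx : x = x') (hy : y = y') (hz : z = z') :
    elt ρ x y z = elt ρ x' y' z' := by
  rw [hx, hy, hz]

variable [NumberField K]

/-- The linear form `x + y ρ + z g₃ ↦ l x + m y + n z` is `α ↦ Tr (δ α)` for a totally positive
element `δ` of the codifferent. -/
def IsDualForm (ρ : K) (l m n : ℤ) : Prop :=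
  ∃ δ ∈ codifferent K, IsTotallyPositive δ ∧
    ∀ x y z : ℤ, Algebra.trace ℚ K (δ * elt ρ x y z) = (l * x + m * y + n * z : ℤ)

/-- The linear forms `l x + m y + n z`, as triples `(l, m, n)`, that support the faces of the convex
hull of the totally positive integers used below: the four faces with more than three lattice
points, the three triangles of index `13`, the unimodular triangle, and five translates of these
faces by units. -/
def dualForms : List (ℤ × ℤ × ℤ) :=
  [(7, 0, 5), (87, -2, 49), (3, 2, 15), (1, 0, 1), (1527, -34, 867), (63, -2, 37), (13, 36, 241),
    (2, -1, 1), (1809, -42, 1016), (2, 43, 278), (4, -1, 2), (1682, -39, 945), (1, 40, 258)]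

section

variable (hρ : ρ ^ 3 - 41 * ρ ^ 2 - 44 * ρ - 1 = 0)
  (hK : IntermediateField.adjoin ℚ {ρ} = (⊤ : IntermediateField ℚ K))
include hρ hK

/-- The form is given by `δ = (A + B ρ + C g₃) / 259`. -/
theorem isDualForm_of_coords {l m n : ℤ} (A B C : ℤ)
    (h : 0 < trForm A B C ∧ 0 < symForm A B C ∧ 0 < normForm A B C)
    (hl : trForm A B C = 259 * l) (hm : 41 * A + 1769 * B + 11401 * C = 259 * m)
    (hn : 272 * A + 11401 * B + 73526 * C = 259 * n) : IsDualForm ρ l m n := by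
  have htr : ∀ x y z : ℤ, Algebra.trace ℚ K ((1 / 259 : ℚ) • elt ρ A B C * elt ρ x y z)
      = (l * x + m * y + n * z : ℤ) := by
    intro x y z
    rw [smul_mul_assoc, map_smul, elt_mul hρ, trace_elt hρ hK]
    have : trForm (A * x - 4 * (B * y) - 25 * (B * z + C * y) - 161 * (C * z))
        (A * y + B * x - 3 * (B * y) - 12 * (B * z + C * y) - 79 * (C * z))
        (A * z + C * x + 7 * (B * y) + 44 * (B * z + C * y) + 284 * (C * z))
        = 259 * (l * x + m * y + n * z) := by
      simp only [trForm] at hl ⊢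
      linear_combination x * hl + y * hm + z * hn
    rw [this, smul_eq_mul]
    push_cast
    ring
  refine ⟨(1 / 259 : ℚ) • elt ρ A B C, mem_codifferent.2 fun α => ?_, fun σ => ?_, htr⟩
  · obtain ⟨x, y, z, h⟩ := (isIntegral_iff_exists_elt hρ hK).1 α.2
    have h' : (α : K) = elt ρ x y z := h
    exact ⟨_, by rw [h']; exact htr x y z⟩
  · rw [Rat.smul_def, map_mul]
    have := (isTotallyPositive_elt_iff hρ hK A B C).2 h σ
    simp only [map_ratCast]
    push_cast
    positivity

theorem IsDualForm.pos {l m n : ℤ} (h : IsDualForm ρ l m n) {x y z : ℤ}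
    (hp : IsTotallyPositive (elt ρ x y z)) : 0 < l * x + m * y + n * z := by
  obtain ⟨δ, -, hδ, e⟩ := h
  have := (hδ.mul hp).trace_pos hρ hK
  rw [e] at this
  exact_mod_cast this

theorem isDualForm_of_mem {l m n : ℤ} (h : (l, m, n) ∈ dualForms) : IsDualForm ρ l m n := by
  simp only [dualForms, List.mem_cons, Prod.mk.injEq, List.not_mem_nil, or_false] at h
  rcases h with ⟨rfl, rfl, rfl⟩ | ⟨rfl, rfl, rfl⟩ | ⟨rfl, rfl, rfl⟩ | ⟨rfl, rfl, rfl⟩ |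
    ⟨rfl, rfl, rfl⟩ | ⟨rfl, rfl, rfl⟩ | ⟨rfl, rfl, rfl⟩ | ⟨rfl, rfl, rfl⟩ | ⟨rfl, rfl, rfl⟩ |
    ⟨rfl, rfl, rfl⟩ | ⟨rfl, rfl, rfl⟩ | ⟨rfl, rfl, rfl⟩ | ⟨rfl, rfl, rfl⟩
  · exact isDualForm_of_coords hρ hK 2024 1893 (-301) (by decide) (by decide) (by decide)
      (by decide)
  · exact isDualForm_of_coords hρ hK 25184 23565 (-3747) (by decide) (by decide) (by decide)
      (by decide)
  · exact isDualForm_of_coords hρ hK 854 799 (-127) (by decide) (by decide) (by decide)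
      (by decide)
  · exact isDualForm_of_coords hρ hK 274 245 (-39) (by decide) (by decide) (by decide)
      (by decide)
  · exact isDualForm_of_coords hρ hK 442022 413611 (-65767) (by decide) (by decide) (by decide)
      (by decide)
  · exact isDualForm_of_coords hρ hK 17972 16617 (-2643) (by decide) (by decide) (by decide)
      (by decide)
  · exact isDualForm_of_coords hρ hK 3502 3269 (-519) (by decide) (by decide) (by decide)
      (by decide)
  · exact isDualForm_of_coords hρ hK 267 13 (-3) (by decide) (by decide) (by decide)
      (by decide)
  · exact isDualForm_of_coords hρ hK 523667 490010 (-77915) (by decide) (by decide) (by decide)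
      (by decide)
  · exact isDualForm_of_coords hρ hK 282 264 (-41) (by decide) (by decide) (by decide)
      (by decide)
  · exact isDualForm_of_coords hρ hK 868 592 (-95) (by decide) (by decide) (by decide)
      (by decide)
  · exact isDualForm_of_coords hρ hK 486903 455609 (-72445) (by decide) (by decide) (by decide)
      (by decide)
  · exact isDualForm_of_coords hρ hK 13 12 (-1) (by decide) (by decide) (by decide)
      (by decide)

/-- Multiplication by a totally positive unit `a + b ρ + c g₃` with inverse `a' + b' ρ + c' g₃`. -/
theorem associatedByTPUnit_elt (a b c a' b' c' : ℤ)
    (h : 0 < trForm a b c ∧ 0 < symForm a b c ∧ 0 < normForm a b c)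
    (h0 : a * a' - 4 * (b * b') - 25 * (b * c' + c * b') - 161 * (c * c') = 1)
    (h1 : a * b' + b * a' - 3 * (b * b') - 12 * (b * c' + c * b') - 79 * (c * c') = 0)
    (h2 : a * c' + c * a' + 7 * (b * b') + 44 * (b * c' + c * b') + 284 * (c * c') = 0)
    {x y z p q r : ℤ}
    (hp : p = a * x - 4 * (b * y) - 25 * (b * z + c * y) - 161 * (c * z))
    (hq : q = a * y + b * x - 3 * (b * y) - 12 * (b * z + c * y) - 79 * (c * z))
    (hr : r = a * z + c * x + 7 * (b * y) + 44 * (b * z + c * y) + 284 * (c * z)) :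
    AssociatedByTPUnit (elt ρ p q r) (elt ρ x y z) := by
  rw [hp, hq, hr, ← elt_mul hρ]
  refine associatedByTPUnit_mul (isIntegral_elt hρ _ _ _) (isIntegral_elt hρ a' b' c') ?_
    ((isTotallyPositive_elt_iff hρ hK a b c).2 h) _
  rw [elt_mul hρ, h0, h1, h2]
  simp [elt]

/-- Multiplication by `ρ ^ 2`. -/
theorem associated_sq_rho (x y z : ℤ) :
    AssociatedByTPUnit (elt ρ (-4 * x - 163 * y - 1052 * z) (-3 * x - 79 * y - 517 * z)
      (7 * x + 287 * y + 1852 * z)) (elt ρ x y z) :=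
  associatedByTPUnit_elt hρ hK (-4) (-3) 7 2071 1937 (-308) (by decide) (by decide) (by decide)
    (by decide) (by ring) (by ring) (by ring)

theorem associated_sq_rho_inv (x y z : ℤ) :
    AssociatedByTPUnit (elt ρ (2071 * x - 48 * y + 1163 * z) (1937 * x - 44 * y + 1088 * z)
      (-308 * x + 7 * y - 173 * z)) (elt ρ x y z) :=
  associatedByTPUnit_elt hρ hK 2071 1937 (-308) (-4) (-3) 7 (by decide) (by decide) (by decide)
    (by decide) (by ring) (by ring) (by ring)

/-- Multiplication by `(1 + 1 / ρ) ^ 2`, the square of a conjugate of `ρ`. -/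
theorem associated_sq_conj (x y z : ℤ) :
    AssociatedByTPUnit (elt ρ (1976 * x - 46 * y + 1109 * z) (1849 * x - 43 * y + 1038 * z)
      (-294 * x + 7 * y - 164 * z)) (elt ρ x y z) :=
  associatedByTPUnit_elt hρ hK 1976 1849 (-294) (-214) (-1936) 301 (by decide) (by decide)
    (by decide) (by decide) (by ring) (by ring) (by ring)

theorem associated_sq_conj_inv (x y z : ℤ) :
    AssociatedByTPUnit (elt ρ (-214 * x + 219 * y - 61 * z) (-1936 * x + 1982 * y - 547 * z)
      (301 * x - 308 * y + 86 * z)) (elt ρ x y z) :=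
  associatedByTPUnit_elt hρ hK (-214) (-1936) 301 1976 1849 (-294) (by decide) (by decide)
    (by decide) (by decide) (by ring) (by ring) (by ring)

/-- Multiplication by `(1 + ρ) ^ 2`. -/
theorem associated_sq_rho_add_one (x y z : ℤ) :
    AssociatedByTPUnit (elt ρ (-3 * x - 171 * y - 1102 * z) (-x - 84 * y - 541 * z)
      (7 * x + 301 * y + 1941 * z)) (elt ρ x y z) :=
  associatedByTPUnit_elt hρ hK (-3) (-1) 7 (-203) (-1846) 287 (by decide) (by decide) (by decide)
    (by decide) (by ring) (by ring) (by ring)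

theorem associated_sq_rho_add_one_inv (x y z : ℤ) :
    AssociatedByTPUnit (elt ρ (-203 * x + 209 * y - 57 * z) (-1846 * x + 1891 * y - 521 * z)
      (287 * x - 294 * y + 81 * z)) (elt ρ x y z) :=
  associatedByTPUnit_elt hρ hK (-203) (-1846) 287 (-3) (-1) 7 (by decide) (by decide) (by decide)
    (by decide) (by ring) (by ring) (by ring)

end

end

/-! ### Generation of the totally positive integers -/

section

variable {K : Type*} [Field K]

/-- The additive monoid generated by the listed elements and their multiples by totally positive
units. -/
def listedMonoid (ρ : K) : AddSubmonoid K :=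
  AddSubmonoid.closure {α | ∃ β ∈ list₁ ρ ∪ list₂ ρ ∪ list₃ ρ, AssociatedByTPUnit α β}

variable {ρ : K}

theorem mem_of_mem_list {α : K} (h : α ∈ list₁ ρ ∪ list₂ ρ ∪ list₃ ρ) : α ∈ listedMonoid ρ :=
  AddSubmonoid.subset_closure ⟨α, h, .refl α⟩

theorem mem_of_associated {α β : K} (h : AssociatedByTPUnit α β) (hβ : β ∈ listedMonoid ρ) :
    α ∈ listedMonoid ρ := by
  obtain ⟨u, hu, rfl⟩ := h
  induction hβ using AddSubmonoid.closure_induction with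
  | mem x hx =>
    obtain ⟨γ, hγ, hx⟩ := hx
    exact AddSubmonoid.subset_closure ⟨γ, hγ, AssociatedByTPUnit.trans ⟨u, hu, rfl⟩ hx⟩
  | zero => simp
  | add x y _ _ hx hy => rw [mul_add]; exact add_mem hx hy

theorem elt_mem_of_eq {P : AddSubmonoid K} {x y z x' y' z' : ℤ} (h : elt ρ x y z ∈ P)
    (hx : x' = x) (hy : y' = y) (hz : z' = z) : elt ρ x' y' z' ∈ P := by
  rwa [hx, hy, hz]

section Families

-- The suffixes `A`, `B`, `C` refer to the three pentagonal faces, with the forms `x + z`,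
-- `3 x + 2 y + 15 z` and `87 x - 2 y + 49 z`, whose rows parallel to their longest edge are the
-- families named `row`. The families named `inner` lie over the triangles of index `13`, in rows
-- parallel to those of the pentagon with the same suffix.

theorem one_mem_listed : elt ρ 1 0 0 ∈ listedMonoid ρ := by
  rw [show elt ρ 1 0 0 = 1 by simp [elt]]
  exact mem_of_mem_list (.inl (.inl (.inl (.inl (.inl (.inl (.inl (.inl (.inl rfl)))))))))

theorem triangle_mem_listed (v w : ℤ) (h1 : 0 ≤ v) (h2 : v ≤ 5) (h3 : 46 * v + 14 ≤ w)
    (h4 : w ≤ 45 * v + 19) : elt ρ (-(5 * v + 2)) (-w) (7 * v + 3) ∈ listedMonoid ρ :=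
  mem_of_mem_list (.inl (.inl (.inl (.inl (.inl (.inl (.inl (.inl (.inr
    ⟨v, w, h1, h2, h3, h4, rfl⟩)))))))))

theorem rowA_mem_listed (v : ℤ) (h1 : 1 ≤ v) (h2 : v ≤ 6) : elt ρ 0 (-v) 1 ∈ listedMonoid ρ :=
  mem_of_mem_list (.inl (.inl (.inl (.inl (.inl (.inl (.inl (.inr ⟨v, h1, h2, rfl⟩))))))))

theorem rowA'_mem_listed (v : ℤ) (h1 : 1 ≤ v) (h2 : v ≤ 12) :
    elt ρ (-1) (-v) 2 ∈ listedMonoid ρ :=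
  mem_of_mem_list (.inl (.inl (.inl (.inl (.inl (.inl (.inr ⟨v, h1, h2, rfl⟩)))))))

theorem rowB_mem_listed (v : ℤ) (h1 : 0 ≤ v) (h2 : v ≤ 5) :
    elt ρ (-(5 * v + 125)) (-(45 * v + 1132)) (7 * v + 176) ∈ listedMonoid ρ :=
  mem_of_mem_list (.inl (.inl (.inl (.inl (.inl (.inr ⟨v, h1, h2, rfl⟩))))))

theorem rowB'_mem_listed (v : ℤ) (h1 : 0 ≤ v) (h2 : v ≤ 11) :
    elt ρ (-(5 * v + 31)) (-(45 * v + 283)) (7 * v + 44) ∈ listedMonoid ρ :=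
  mem_of_mem_list (.inl (.inl (.inl (.inl (.inr ⟨v, h1, h2, rfl⟩)))))

theorem rowC_mem_listed (v : ℤ) (h1 : 0 ≤ v) (h2 : v ≤ 5) :
    elt ρ (-(5 * v + 5)) (-(46 * v + 22)) (7 * v + 8) ∈ listedMonoid ρ :=
  mem_of_mem_list (.inl (.inl (.inl (.inr ⟨v, h1, h2, rfl⟩))))

theorem rowC'_mem_listed (v : ℤ) (h1 : 0 ≤ v) (h2 : v ≤ 11) :
    elt ρ (-(5 * v + 6)) (-(46 * v + 41)) (7 * v + 9) ∈ listedMonoid ρ :=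
  mem_of_mem_list (.inl (.inl (.inr ⟨v, h1, h2, rfl⟩)))

theorem innerA_mem_listed (v : ℤ) (h1 : 9 ≤ v) (h2 : v ≤ 14) :
    elt ρ (-3) (-v) 5 ∈ listedMonoid ρ :=
  mem_of_mem_list (.inl (.inr (.inl (.inl (.inl ⟨v, h1, h2, rfl⟩)))))

theorem innerB_mem_listed (v : ℤ) (h1 : 0 ≤ v) (h2 : v ≤ 5) :
    elt ρ (-(5 * v + 3)) (-(45 * v + 32)) (7 * v + 5) ∈ listedMonoid ρ :=
  mem_of_mem_list (.inl (.inr (.inl (.inl (.inr ⟨v, h1, h2, rfl⟩)))))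

theorem innerC_mem_listed (v : ℤ) (h1 : 0 ≤ v) (h2 : v ≤ 5) :
    elt ρ (-(5 * v + 93)) (-(46 * v + 837)) (7 * v + 131) ∈ listedMonoid ρ :=
  mem_of_mem_list (.inl (.inr (.inl (.inr ⟨v, h1, h2, rfl⟩))))

theorem innerA'_mem_listed (v : ℤ) (h1 : 4 ≤ v) (h2 : v ≤ 9) :
    elt ρ (-4) (-v) 7 ∈ listedMonoid ρ := by
  rcases h1.eq_or_lt with rfl | h1
  · exact mem_of_mem_list (.inl (.inr (.inr (.inl rfl))))
  · exact mem_of_mem_list (.inr (.inl (.inl ⟨v, h1, h2, rfl⟩)))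

theorem innerB'_mem_listed (v : ℤ) (h1 : 0 ≤ v) (h2 : v ≤ 5) :
    elt ρ (-(5 * v + 4)) (-(45 * v + 45)) (7 * v + 7) ∈ listedMonoid ρ := by
  rcases h1.eq_or_lt with rfl | h1
  · exact mem_of_mem_list (.inl (.inr (.inr (.inr (.inl rfl)))))
  · exact mem_of_mem_list (.inr (.inl (.inr ⟨v, h1, h2, rfl⟩)))

theorem innerC'_mem_listed (v : ℤ) (h1 : 0 ≤ v) (h2 : v ≤ 5) :
    elt ρ (-(5 * v + 184)) (-(46 * v + 1660)) (7 * v + 259) ∈ listedMonoid ρ := by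
  rcases h2.eq_or_lt with rfl | h2
  · exact mem_of_mem_list (.inl (.inr (.inr (.inr (.inr rfl)))))
  · exact mem_of_mem_list (.inr (.inr ⟨v, h1, by omega, rfl⟩))

end Families

variable [NumberField K] (hρ : ρ ^ 3 - 41 * ρ ^ 2 - 44 * ρ - 1 = 0)
  (hK : IntermediateField.adjoin ℚ {ρ} = (⊤ : IntermediateField ℚ K))
include hρ hK

/-- Remaining lattice points of the faces: multiples of listed elements by units other than `1`. -/
theorem vertices_mem_listed :
    elt ρ (-4) (-3) 7 ∈ listedMonoid ρ ∧ elt ρ (-214) (-1936) 301 ∈ listedMonoid ρ ∧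
    elt ρ 0 0 1 ∈ listedMonoid ρ ∧ elt ρ (-120) (-1087) 169 ∈ listedMonoid ρ ∧
    elt ρ (-35) (-298) 50 ∈ listedMonoid ρ ∧ elt ρ (-2) (-1) 4 ∈ listedMonoid ρ := by
  refine ⟨?_, ?_, ?_, ?_, ?_, ?_⟩
  · exact elt_mem_of_eq (mem_of_associated (associated_sq_rho hρ hK 1 0 0) one_mem_listed)
      (by norm_num) (by norm_num) (by norm_num)
  · exact elt_mem_of_eq (mem_of_associated (associated_sq_conj_inv hρ hK 1 0 0) one_mem_listed)
      (by norm_num) (by norm_num) (by norm_num)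
  · exact elt_mem_of_eq (mem_of_associated (associated_sq_conj hρ hK (-61) (-547) 86)
      (rowC'_mem_listed 11 (by norm_num) (by norm_num)))
      (by norm_num) (by norm_num) (by norm_num)
  · exact elt_mem_of_eq (mem_of_associated (associated_sq_rho_add_one_inv hρ hK (-1) (-1) 2)
      (rowA'_mem_listed 1 (by norm_num) (by norm_num)))
      (by norm_num) (by norm_num) (by norm_num)
  · exact elt_mem_of_eq (mem_of_associated (associated_sq_rho hρ hK (-31) (-283) 44)
      (rowB'_mem_listed 0 (by norm_num) (by norm_num)))
      (by norm_num) (by norm_num) (by norm_num)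
  · exact elt_mem_of_eq (mem_of_associated (associated_sq_rho_add_one hρ hK (-31) (-283) 44)
      (rowB'_mem_listed 0 (by norm_num) (by norm_num)))
      (by norm_num) (by norm_num) (by norm_num)

/-- The supporting linear forms of the eight faces, normalised to take the value `13` on the
face. -/
def faceForm : Fin 8 → ℤ → ℤ → ℤ → ℤ
  | 0, x, _, z => 13 * (7 * x + 5 * z)
  | 1, x, y, z => 13 * (87 * x - 2 * y + 49 * z)
  | 2, x, y, z => 13 * (3 * x + 2 * y + 15 * z)
  | 3, x, _, z => 13 * (x + z)
  | 4, x, y, z => 1527 * x - 34 * y + 867 * z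
  | 5, x, y, z => 63 * x - 2 * y + 37 * z
  | 6, x, y, z => 13 * (2 * x - y + z)
  | 7, x, y, z => 13 * x + 36 * y + 241 * z

theorem faceForm_pos {x y z : ℤ} (h : IsTotallyPositive (elt ρ x y z)) (i : Fin 8) :
    0 < faceForm i x y z := by
  have := (isDualForm_of_mem hρ hK (l := 7) (m := 0) (n := 5) (by decide)).pos hρ hK
    h
  have := (isDualForm_of_mem hρ hK (l := 87) (m := (-2)) (n := 49) (by decide)).pos hρ hK
    h
  have := (isDualForm_of_mem hρ hK (l := 3) (m := 2) (n := 15) (by decide)).pos hρ hK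
    h
  have := (isDualForm_of_mem hρ hK (l := 1) (m := 0) (n := 1) (by decide)).pos hρ hK
    h
  have := (isDualForm_of_mem hρ hK (l := 1527) (m := (-34)) (n := 867) (by decide)).pos hρ hK
    h
  have := (isDualForm_of_mem hρ hK (l := 63) (m := (-2)) (n := 37) (by decide)).pos hρ hK
    h
  have := (isDualForm_of_mem hρ hK (l := 2) (m := (-1)) (n := 1) (by decide)).pos hρ hK
    h
  have := (isDualForm_of_mem hρ hK (l := 13) (m := 36) (n := 241) (by decide)).pos hρ hK
    h
  fin_cases i <;> simp only [faceForm] <;> omega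

/-- Every totally positive integer has an associate at which one of the face forms takes the least
value that the face forms take on associates. -/
theorem exists_minimal_associate {α : K} (hi : IsIntegral ℤ α) (hp : IsTotallyPositive α) :
    ∃ (i : Fin 8) (x y z : ℤ), AssociatedByTPUnit α (elt ρ x y z) ∧
      ∀ (j : Fin 8) (x' y' z' : ℤ), AssociatedByTPUnit (elt ρ x' y' z') (elt ρ x y z) →
        faceForm i x y z ≤ faceForm j x' y' z' := by
  classical
  have hex : ∃ n : ℕ, ∃ (i : Fin 8) (x y z : ℤ), AssociatedByTPUnit α (elt ρ x y z) ∧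
      faceForm i x y z = n := by
    obtain ⟨x, y, z, rfl⟩ := (isIntegral_iff_exists_elt hρ hK).1 hi
    exact ⟨(faceForm 0 x y z).toNat, 0, x, y, z, .refl _,
      (Int.toNat_of_nonneg (faceForm_pos hρ hK hp 0).le).symm⟩
  obtain ⟨i, x, y, z, h, hn⟩ := Nat.find_spec hex
  refine ⟨i, x, y, z, h, fun j x' y' z' h' => ?_⟩
  have h2 := h.trans h'.symm
  have hpos := faceForm_pos hρ hK (h2.symm.isTotallyPositive hp) j
  have := Nat.find_min' hex ⟨j, x', y', z', h2, (Int.toNat_of_nonneg hpos.le).symm⟩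
  rw [hn]
  omega

/-- An integer that is minimal for the face form of a face lies in the cone over that face, by
comparison with the forms of the adjacent faces, and so is a sum of listed elements. -/
theorem mem_listedMonoid_of_minimal {i : Fin 8} {x y z : ℤ}
    (h : ∀ (j : Fin 8) (x' y' z' : ℤ), AssociatedByTPUnit (elt ρ x' y' z') (elt ρ x y z) →
      faceForm i x y z ≤ faceForm j x' y' z') : elt ρ x y z ∈ listedMonoid ρ := by
  obtain ⟨v1, v2, v3, v4, v5, v6⟩ := vertices_mem_listed hρ hK
  have hs := fun j => h j _ _ _ (.refl _)
  have u1 := fun j => h j _ _ _ (associated_sq_rho hρ hK x y z)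
  have u1' := fun j => h j _ _ _ (associated_sq_rho_inv hρ hK x y z)
  have u2 := fun j => h j _ _ _ (associated_sq_conj hρ hK x y z)
  have u2' := fun j => h j _ _ _ (associated_sq_conj_inv hρ hK x y z)
  have u3 := fun j => h j _ _ _ (associated_sq_rho_add_one hρ hK x y z)
  have u3' := fun j => h j _ _ _ (associated_sq_rho_add_one_inv hρ hK x y z)
  clear h
  fin_cases i <;> simp only [Fin.zero_eta, Fin.mk_one, Fin.reduceFinMk] at hs u1 u1' u2 u2' u3 u3'
  -- The triangle of side `5`.
  · have a1 := hs 1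
    have a2 := hs 2
    have a3 := hs 3
    simp only [faceForm] at a1 a2 a3
    clear hs u1 u1' u2 u2' u3 u3'
    have := triangle_mem (P := listedMonoid ρ) (b := elt ρ (-2) (-19) 3) (f := elt ρ 0 1 0)
      (h := elt ρ (-5) (-45) 7) (fun i j hi hj hij => by
        simp only [zsmul_elt, elt_add]
        exact elt_mem_of_eq (triangle_mem_listed j (19 - i + 45 * j) hj (by omega) (by omega)
          (by omega)) (by ring) (by ring) (by ring)) (n := 7 * x + 5 * z) (i := -2 * x + y + 5 * z)
      (j := -3 * x - 2 * z) (by omega) (by omega) (by omega)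
    simp only [zsmul_elt, elt_add] at this
    exact elt_mem_of_eq this (by ring) (by ring) (by ring)
  -- The pentagon `C`.
  · have a1 := hs 0
    have a2 := hs 4
    have a3 := hs 5
    have a4 := u2 6
    have a5 := u1' 7
    simp only [faceForm] at a1 a2 a3 a4 a5
    clear hs u1 u1' u2 u2' u3 u3'
    have := pentagon_mem (P := listedMonoid ρ) (e := elt ρ (-4) (-3) 7)
      (s := elt ρ (-31) (-295) 43) (d := elt ρ (-5) (-46) 7) v1
      (fun k h1 h2 => by
        simp only [zsmul_elt, elt_add]
        rcases h2.eq_or_lt with rfl | h2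
        · simpa using v5
        · exact elt_mem_of_eq (rowC_mem_listed (k + 6) (by omega) (by omega)) (by ring) (by ring)
            (by ring))
      (fun k h1 h2 => by
        simp only [zsmul_elt, elt_add]
        exact elt_mem_of_eq (rowC'_mem_listed (k + 12) (by omega) (by omega)) (by ring) (by ring)
            (by ring))
      (fun k h1 h2 => by
        simp only [zsmul_elt, elt_add]
        exact elt_mem_of_eq (triangle_mem_listed (k + 19) (46 * (k + 19) + 14) (by omega) (by omega)
          (by omega) (by omega)) (by ring) (by ring) (by ring))
      (n := 87 * x - 2 * y + 49 * z) (i := 301 * x - 7 * y + 169 * z)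
      (k := -1936 * x + 45 * y - 1087 * z) (by omega) (by omega) (by omega) (by omega) (by omega)
    simp only [zsmul_elt, elt_add] at this
    exact elt_mem_of_eq this (by ring) (by ring) (by ring)
  -- The pentagon `B`.
  · have a1 := hs 0
    have a2 := hs 4
    have a3 := hs 7
    have a4 := u3 5
    have a5 := u3 6
    simp only [faceForm] at a1 a2 a3 a4 a5
    clear hs u1 u1' u2 u2' u3 u3'
    have := pentagon_mem (P := listedMonoid ρ) (e := elt ρ (-214) (-1936) 301)
      (s := elt ρ 94 849 (-132)) (d := elt ρ 5 45 (-7)) v2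
      (fun k h1 h2 => by
        simp only [zsmul_elt, elt_add]
        rcases h2.eq_or_lt with rfl | h2
        · simpa using v4
        · exact elt_mem_of_eq (rowB_mem_listed (-1 - k) (by omega) (by omega)) (by ring) (by ring)
            (by ring))
      (fun k h1 h2 => by
        simp only [zsmul_elt, elt_add]
        exact elt_mem_of_eq (rowB'_mem_listed (-1 - k) (by omega) (by omega)) (by ring) (by ring)
            (by ring))
      (fun k h1 h2 => by
        simp only [zsmul_elt, elt_add]
        exact elt_mem_of_eq (triangle_mem_listed (-14 - k) (45 * (-14 - k) + 19) (by omega)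
          (by omega) (by omega) (by omega)) (by ring) (by ring) (by ring))
      (n := 3 * x + 2 * y + 15 * z) (i := 7 * x + 7 * y + 50 * z)
      (k := -3 * x - 46 * y - 298 * z) (by omega) (by omega) (by omega) (by omega) (by omega)
    simp only [zsmul_elt, elt_add] at this
    exact elt_mem_of_eq this (by ring) (by ring) (by ring)
  -- The pentagon `A`.
  · have a1 := hs 0
    have a2 := hs 5
    have a3 := hs 6
    have a4 := hs 7
    have a5 := u2' 4
    simp only [faceForm] at a1 a2 a3 a4 a5
    clear hs u1 u1' u2 u2' u3 u3'
    have := pentagon_mem (P := listedMonoid ρ) (e := elt ρ 1 0 0)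
      (s := elt ρ (-1) 0 1) (d := elt ρ 0 1 0) one_mem_listed
      (fun k h1 h2 => by
        simp only [zsmul_elt, elt_add]
        rcases h2.eq_or_lt with rfl | h2
        · simpa using v3
        · exact elt_mem_of_eq (rowA_mem_listed (-k) (by omega) (by omega)) (by ring) (by ring)
            (by ring))
      (fun k h1 h2 => by
        simp only [zsmul_elt, elt_add]
        exact elt_mem_of_eq (rowA'_mem_listed (-k) (by omega) (by omega)) (by ring) (by ring)
            (by ring))
      (fun k h1 h2 => by
        simp only [zsmul_elt, elt_add]
        exact elt_mem_of_eq (triangle_mem_listed 0 (-k) (by omega) (by omega)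
          (by omega) (by omega)) (by ring) (by ring) (by ring))
      (n := x + z) (i := z) (k := y) (by omega) (by omega) (by omega) (by omega) (by omega)
    simp only [zsmul_elt, elt_add] at this
    exact elt_mem_of_eq this (by ring) (by ring) (by ring)
  -- The triangle of index `13` whose rows are parallel to those of pentagon `C`.
  · have a1 := hs 1
    have a2 := hs 2
    have a3 := u2 3
    simp only [faceForm] at a1 a2 a3
    clear hs u1 u1' u2 u2' u3 u3'
    have := index13_mem (P := listedMonoid ρ) (V := elt ρ (-214) (-1936) 301)
      (R := elt ρ (-118) (-1067) 166) (d := elt ρ 5 46 (-7))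
      (fun k h1 h2 => by
        simp only [zsmul_elt, elt_add]
        rcases h1.eq_or_lt with rfl | h1
        · simpa using v2
        · exact elt_mem_of_eq (innerC'_mem_listed (6 - k) (by omega) (by omega)) (by ring) (by ring)
            (by ring))
      (fun k h1 h2 => by
        simp only [zsmul_elt, elt_add]
        exact elt_mem_of_eq (innerC_mem_listed (5 - k) (by omega) (by omega)) (by ring) (by ring)
            (by ring))
      (by
        simp only [zsmul_elt, elt_sub]
        exact triangle_mem_listed 5 244 (by norm_num) (by norm_num) (by norm_num) (by norm_num))
      (by
        simp only [zsmul_elt, elt_sub, elt_add]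
        exact rowC'_mem_listed 11 (by norm_num) (by norm_num))
      (p := -167 * x + 4 * y - 93 * z) (q := 294 * x - 7 * y + 164 * z)
      (r := -209 * x + 6 * y - 110 * z) (by omega) (by omega) (by omega)
    simp only [zsmul_elt, elt_add] at this
    exact elt_mem_of_eq this (by ring) (by ring) (by ring)
  -- The triangle of index `13` whose rows are parallel to those of pentagon `A`.
  · have a1 := hs 1
    have a2 := hs 3
    have a3 := u3' 2
    simp only [faceForm] at a1 a2 a3
    clear hs u1 u1' u2 u2' u3 u3'
    have := index13_mem (P := listedMonoid ρ) (V := elt ρ (-4) (-3) 7)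
      (R := elt ρ (-3) (-9) 5) (d := elt ρ 0 (-1) 0)
      (fun k h1 h2 => by
        simp only [zsmul_elt, elt_add]
        rcases h1.eq_or_lt with rfl | h1
        · simpa using v1
        · exact elt_mem_of_eq (innerA'_mem_listed (3 + k) (by omega) (by omega)) (by ring) (by ring)
            (by ring))
      (fun k h1 h2 => by
        simp only [zsmul_elt, elt_add]
        exact elt_mem_of_eq (innerA_mem_listed (9 + k) (by omega) (by omega)) (by ring) (by ring)
            (by ring))
      (by
        simp only [zsmul_elt, elt_sub]
        exact triangle_mem_listed 0 14 (by norm_num) (by norm_num) (by norm_num) (by norm_num))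
      (by
        simp only [zsmul_elt, elt_sub, elt_add]
        exact rowA'_mem_listed 1 (by norm_num) (by norm_num))
      (p := 5 * x + 3 * z) (q := -7 * x - 4 * z)
      (r := 48 * x - y + 27 * z) (by omega) (by omega) (by omega)
    simp only [zsmul_elt, elt_add] at this
    exact elt_mem_of_eq this (by ring) (by ring) (by ring)
  -- The unimodular triangle.
  · have a1 := hs 3
    have a2 := u2' 1
    have a3 := u3' 2
    simp only [faceForm] at a1 a2 a3
    clear hs u1 u1' u2 u2' u3 u3'
    have := add_mem (add_mem (zsmul_mem_of_nonneg v3 (n := 2 * x + z) (by omega))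
      (zsmul_mem_of_nonneg (rowA'_mem_listed 1 (by norm_num) (by norm_num)) (n := x - 2 * y)
        (by omega)))
      (zsmul_mem_of_nonneg v6 (n := -x + y) (by omega))
    simp only [zsmul_elt, elt_add] at this
    exact elt_mem_of_eq this (by ring) (by ring) (by ring)
  -- The triangle of index `13` whose rows are parallel to those of pentagon `B`.
  · have a1 := hs 2
    have a2 := hs 3
    have a3 := u1 1
    simp only [faceForm] at a1 a2 a3
    clear hs u1 u1' u2 u2' u3 u3'
    have := index13_mem (P := listedMonoid ρ) (V := elt ρ 1 0 0)
      (R := elt ρ (-3) (-32) 5) (d := elt ρ (-5) (-45) 7)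
      (fun k h1 h2 => by
        simp only [zsmul_elt, elt_add]
        rcases h1.eq_or_lt with rfl | h1
        · simpa using one_mem_listed
        · exact elt_mem_of_eq (innerB'_mem_listed (k - 1) (by omega) (by omega)) (by ring) (by ring)
            (by ring))
      (fun k h1 h2 => by
        simp only [zsmul_elt, elt_add]
        exact elt_mem_of_eq (innerB_mem_listed k (by omega) (by omega)) (by ring) (by ring)
            (by ring))
      (by
        simp only [zsmul_elt, elt_sub]
        exact triangle_mem_listed 0 19 (by norm_num) (by norm_num) (by norm_num) (by norm_num))
      (by
        simp only [zsmul_elt, elt_sub, elt_add]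
        exact rowB'_mem_listed 0 (by norm_num) (by norm_num))
      (p := x - 4 * y - 25 * z) (q := 7 * y + 45 * z)
      (r := -5 * y - 32 * z) (by omega) (by omega) (by omega)
    simp only [zsmul_elt, elt_add] at this
    exact elt_mem_of_eq this (by ring) (by ring) (by ring)

theorem mem_listedMonoid {α : K} (hi : IsIntegral ℤ α) (hp : IsTotallyPositive α) :
    α ∈ listedMonoid ρ := by
  obtain ⟨i, x, y, z, h, hmin⟩ := exists_minimal_associate hρ hK hi hp
  exact mem_of_associated h (mem_listedMonoid_of_minimal hρ hK hmin)

end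

/-! ### The list in coordinates -/

section

/-- The integers `a, a + 1, …, a + n - 1`. -/
def intRange (a : ℤ) (n : ℕ) : List ℤ := (List.range n).map fun k : ℕ => a + (k : ℤ)

theorem mem_intRange {a k : ℤ} {n : ℕ} : k ∈ intRange a n ↔ a ≤ k ∧ k < a + n := by
  simp only [intRange, List.mem_map, List.mem_range]
  constructor
  · rintro ⟨i, hi, rfl⟩
    omega
  · rintro ⟨h1, h2⟩
    exact ⟨(k - a).toNat, by omega, by omega⟩

/-- The coordinates of the listed elements of minimal trace `1`. -/
def coords₁ : List (ℤ × ℤ × ℤ) :=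
  [(1, 0, 0)]
  ++ ((intRange 0 6).flatMap fun v => (intRange (46 * v + 14) (6 - v).toNat).map fun w =>
      (-(5 * v + 2), -w, 7 * v + 3))
  ++ ((intRange 1 6).map fun v => (0, -v, 1))
  ++ ((intRange 1 12).map fun v => (-1, -v, 2))
  ++ ((intRange 0 6).map fun v => (-(5 * v + 125), -(45 * v + 1132), 7 * v + 176))
  ++ ((intRange 0 12).map fun v => (-(5 * v + 31), -(45 * v + 283), 7 * v + 44))
  ++ ((intRange 0 6).map fun v => (-(5 * v + 5), -(46 * v + 22), 7 * v + 8))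
  ++ ((intRange 0 12).map fun v => (-(5 * v + 6), -(46 * v + 41), 7 * v + 9))

/-- The coordinates of the listed elements of minimal trace `2`. -/
def coords₂ : List (ℤ × ℤ × ℤ) :=
  ((intRange 9 6).map fun v => (-3, -v, 5))
  ++ ((intRange 0 6).map fun v => (-(5 * v + 3), -(45 * v + 32), 7 * v + 5))
  ++ ((intRange 0 6).map fun v => (-(5 * v + 93), -(46 * v + 837), 7 * v + 131))
  ++ [(-4, -4, 7), (-4, -45, 7), (-209, -1890, 294)]

/-- The coordinates of the listed elements of minimal trace `3`. -/
def coords₃ : List (ℤ × ℤ × ℤ) :=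
  ((intRange 5 5).map fun v => (-4, -v, 7))
  ++ ((intRange 1 5).map fun v => (-(5 * v + 4), -(45 * v + 45), 7 * v + 7))
  ++ ((intRange 0 5).map fun v => (-(5 * v + 184), -(46 * v + 1660), 7 * v + 259))

/-- Multiplication in coordinates with respect to `1, ρ, g₃`. -/
def mulCoords (p q : ℤ × ℤ × ℤ) : ℤ × ℤ × ℤ :=
  (p.1 * q.1 - 4 * (p.2.1 * q.2.1) - 25 * (p.2.1 * q.2.2 + p.2.2 * q.2.1) - 161 * (p.2.2 * q.2.2),
    p.1 * q.2.1 + p.2.1 * q.1 - 3 * (p.2.1 * q.2.1) - 12 * (p.2.1 * q.2.2 + p.2.2 * q.2.1)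
      - 79 * (p.2.2 * q.2.2),
    p.1 * q.2.2 + p.2.2 * q.1 + 7 * (p.2.1 * q.2.1) + 44 * (p.2.1 * q.2.2 + p.2.2 * q.2.1)
      + 284 * (p.2.2 * q.2.2))

/-- The norm in coordinates. -/
def normCoords (p : ℤ × ℤ × ℤ) : ℤ := normForm p.1 p.2.1 p.2.2

/-- The product of the other two conjugates of an element, in coordinates: `α² - Tr(α) α + S(α)`,
where `S` is the second elementary symmetric function of the conjugates. -/
def adjCoords (p : ℤ × ℤ × ℤ) : ℤ × ℤ × ℤ :=
  ((mulCoords p p).1 - trForm p.1 p.2.1 p.2.2 * p.1 + symForm p.1 p.2.1 p.2.2,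
    (mulCoords p p).2.1 - trForm p.1 p.2.1 p.2.2 * p.2.1,
    (mulCoords p p).2.2 - trForm p.1 p.2.1 p.2.2 * p.2.2)

theorem normCoords_mul (p q : ℤ × ℤ × ℤ) :
    normCoords (mulCoords p q) = normCoords p * normCoords q := by
  simp only [normCoords, mulCoords, normForm]; ring

theorem mulCoords_adj (p q : ℤ × ℤ × ℤ) :
    mulCoords (mulCoords p q) (adjCoords q)
      = (p.1 * normCoords q, p.2.1 * normCoords q, p.2.2 * normCoords q) := by
  simp only [normCoords, mulCoords, adjCoords, normForm, trForm, symForm, Prod.mk.injEq]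
  refine ⟨?_, ?_, ?_⟩ <;> ring

theorem coords_isTotallyPositive : ∀ p ∈ coords₁ ++ coords₂ ++ coords₃,
    0 < trForm p.1 p.2.1 p.2.2 ∧ 0 < symForm p.1 p.2.1 p.2.2 ∧ 0 < normForm p.1 p.2.1 p.2.2 := by
  decide +kernel

theorem coords_pairwise : ∀ p ∈ coords₁ ++ coords₂ ++ coords₃, ∀ q ∈ coords₁ ++ coords₂ ++ coords₃,
    normCoords p = normCoords q → p ≠ q →
      ¬ (normCoords q ∣ (mulCoords p (adjCoords q)).1 ∧
        normCoords q ∣ (mulCoords p (adjCoords q)).2.1 ∧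
        normCoords q ∣ (mulCoords p (adjCoords q)).2.2) := by
  decide +kernel

end

/-! ### Indecomposability and elements of minimal trace one -/

section

section ListedCoordinates

variable {K : Type*} [Field K] {ρ : K}

theorem exists_coords_of_mem_list₁ {α : K} (h : α ∈ list₁ ρ) :
    ∃ p ∈ coords₁, α = elt ρ p.1 p.2.1 p.2.2 := by
  rcases h with (((((((rfl | ⟨v, w, h1, h2, h3, h4, rfl⟩) | ⟨v, h1, h2, rfl⟩) | ⟨v, h1, h2, rfl⟩) |
    ⟨v, h1, h2, rfl⟩) | ⟨v, h1, h2, rfl⟩) | ⟨v, h1, h2, rfl⟩) | ⟨v, h1, h2, rfl⟩)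
  · exact ⟨(1, 0, 0), by decide +kernel, by simp [elt]⟩
  all_goals
    refine ⟨(_, _, _), ?_, rfl⟩
    simp only [coords₁, List.mem_append, List.mem_map, List.mem_flatMap, mem_intRange]
  · exact .inl (.inl (.inl (.inl (.inl (.inl (.inr ⟨v, by omega, w, by omega, rfl⟩))))))
  · exact .inl (.inl (.inl (.inl (.inl (.inr ⟨v, by omega, rfl⟩)))))
  · exact .inl (.inl (.inl (.inl (.inr ⟨v, by omega, rfl⟩))))
  · exact .inl (.inl (.inl (.inr ⟨v, by omega, rfl⟩)))
  · exact .inl (.inl (.inr ⟨v, by omega, rfl⟩))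
  · exact .inl (.inr ⟨v, by omega, rfl⟩)
  · exact .inr ⟨v, by omega, rfl⟩

theorem exists_coords_of_mem_list₂ {α : K} (h : α ∈ list₂ ρ) :
    ∃ p ∈ coords₂, α = elt ρ p.1 p.2.1 p.2.2 := by
  rcases h with (((⟨v, h1, h2, rfl⟩ | ⟨v, h1, h2, rfl⟩) | ⟨v, h1, h2, rfl⟩) | (rfl | rfl | rfl))
  all_goals
    refine ⟨(_, _, _), ?_, rfl⟩
  · exact List.mem_append.2 (.inl (List.mem_append.2 (.inl (List.mem_append.2 (.inl
      (List.mem_map.2 ⟨v, mem_intRange.2 (by omega), rfl⟩))))))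
  · exact List.mem_append.2 (.inl (List.mem_append.2 (.inl (List.mem_append.2 (.inr
      (List.mem_map.2 ⟨v, mem_intRange.2 (by omega), rfl⟩))))))
  · exact List.mem_append.2 (.inl (List.mem_append.2 (.inr
      (List.mem_map.2 ⟨v, mem_intRange.2 (by omega), rfl⟩))))
  all_goals exact List.mem_append.2 (.inr (by decide))

theorem exists_coords_of_mem_list₃ {α : K} (h : α ∈ list₃ ρ) :
    ∃ p ∈ coords₃, α = elt ρ p.1 p.2.1 p.2.2 := by
  rcases h with ((⟨v, h1, h2, rfl⟩ | ⟨v, h1, h2, rfl⟩) | ⟨v, h1, h2, rfl⟩)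
  all_goals
    refine ⟨(_, _, _), ?_, rfl⟩
    simp only [coords₃, List.mem_append, List.mem_map, mem_intRange]
  · exact .inl (.inl ⟨v, by omega, rfl⟩)
  · exact .inl (.inr ⟨v, by omega, rfl⟩)
  · exact .inr ⟨v, by omega, rfl⟩

theorem exists_coords_of_mem_list {α : K} (h : α ∈ list₁ ρ ∪ list₂ ρ ∪ list₃ ρ) :
    ∃ p ∈ coords₁ ++ coords₂ ++ coords₃, α = elt ρ p.1 p.2.1 p.2.2 := by
  rcases h with (h | h) | h
  · obtain ⟨p, hp, e⟩ := exists_coords_of_mem_list₁ h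
    exact ⟨p, by simp [hp], e⟩
  · obtain ⟨p, hp, e⟩ := exists_coords_of_mem_list₂ h
    exact ⟨p, by simp [hp], e⟩
  · obtain ⟨p, hp, e⟩ := exists_coords_of_mem_list₃ h
    exact ⟨p, by simp [hp], e⟩

theorem isIntegral_of_mem_list [CharZero K] (hρ : ρ ^ 3 - 41 * ρ ^ 2 - 44 * ρ - 1 = 0) {α : K}
    (h : α ∈ list₁ ρ ∪ list₂ ρ ∪ list₃ ρ) : IsIntegral ℤ α := by
  obtain ⟨p, hp, rfl⟩ := exists_coords_of_mem_list h
  exact isIntegral_elt hρ _ _ _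

end ListedCoordinates

variable {K : Type*} [Field K] {ρ : K} [NumberField K]

theorem exists_int_trace {δ α : K} (hδ : δ ∈ codifferent K) (hα : IsIntegral ℤ α) :
    ∃ n : ℤ, Algebra.trace ℚ K (δ * α) = n :=
  mem_codifferent.1 hδ ⟨α, hα⟩

variable (hρ : ρ ^ 3 - 41 * ρ ^ 2 - 44 * ρ - 1 = 0)
  (hK : IntermediateField.adjoin ℚ {ρ} = (⊤ : IntermediateField ℚ K))
include hρ hK

theorem isTotallyPositive_of_mem_list {α : K} (h : α ∈ list₁ ρ ∪ list₂ ρ ∪ list₃ ρ) :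
    IsTotallyPositive α := by
  obtain ⟨p, hp, rfl⟩ := exists_coords_of_mem_list h
  exact (isTotallyPositive_elt_iff hρ hK _ _ _).2 (coords_isTotallyPositive p hp)

theorem list_pairwise : (list₁ ρ ∪ list₂ ρ ∪ list₃ ρ).Pairwise
    (fun α β => ¬ AssociatedByTPUnit α β) := by
  intro α hα β hβ hne hass
  obtain ⟨p, hp, rfl⟩ := exists_coords_of_mem_list hα
  obtain ⟨q, hq, rfl⟩ := exists_coords_of_mem_list hβ
  obtain ⟨u, hu, e⟩ := hass
  obtain ⟨a, b, c, ha⟩ := (isIntegral_iff_exists_elt hρ hK).1 (u : 𝓞 K).2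
  obtain ⟨a', b', c', ha'⟩ := (isIntegral_iff_exists_elt hρ hK).1 ((u⁻¹ : (𝓞 K)ˣ) : 𝓞 K).2
  have hmul : ∀ p q : ℤ × ℤ × ℤ, elt ρ p.1 p.2.1 p.2.2 * elt ρ q.1 q.2.1 q.2.2
      = elt ρ (mulCoords p q).1 (mulCoords p q).2.1 (mulCoords p q).2.2 :=
    fun p q => elt_mul hρ _ _ _ _ _ _
  have hu1 : mulCoords (a, b, c) (a', b', c') = (1, 0, 0) := by
    have h1 : ((u : 𝓞 K) : K) * (((u⁻¹ : (𝓞 K)ˣ) : 𝓞 K) : K) = 1 := by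
      rw [← map_mul, Units.mul_inv, map_one]
    have h2 : elt ρ a b c * elt ρ a' b' c' = elt ρ 1 0 0 := by
      rw [← ha, ← ha', show elt ρ 1 0 0 = 1 by simp [elt]]; exact h1
    obtain ⟨e0, e1, e2⟩ := elt_inj hρ ((hmul (a, b, c) (a', b', c')).symm.trans h2)
    exact Prod.ext e0 (Prod.ext e1 e2)
  have hp1 : p = mulCoords (a, b, c) q := by
    have h2 : elt ρ p.1 p.2.1 p.2.2 = elt ρ a b c * elt ρ q.1 q.2.1 q.2.2 := by
      rw [← ha]; exact e
    obtain ⟨e0, e1, e2⟩ := elt_inj hρ (h2.trans (hmul (a, b, c) q))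
    exact Prod.ext e0 (Prod.ext e1 e2)
  have hN : normCoords (a, b, c) = 1 := by
    have hpos : 0 < normCoords (a, b, c) :=
      ((isTotallyPositive_elt_iff hρ hK a b c).1 (ha ▸ hu)).2.2
    have h1 : normCoords (a, b, c) * normCoords (a', b', c') = 1 := by
      rw [← normCoords_mul, hu1]; rfl
    exact Int.eq_one_of_mul_eq_one_right hpos.le h1
  refine coords_pairwise p hp q hq ?_ (fun h => hne (by rw [h])) ?_
  · rw [hp1, normCoords_mul, hN, one_mul]
  · rw [hp1, mulCoords_adj]
    exact ⟨dvd_mul_left _ _, dvd_mul_left _ _, dvd_mul_left _ _⟩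

theorem mem_listedMonoid_cases {α : K} (h : α ∈ listedMonoid ρ) :
    α = 0 ∨ IsIntegral ℤ α ∧ IsTotallyPositive α ∧
      ((∃ β ∈ list₁ ρ ∪ list₂ ρ ∪ list₃ ρ, AssociatedByTPUnit α β) ∨
        ∃ β γ : K, IsIntegral ℤ β ∧ IsTotallyPositive β ∧
          IsIntegral ℤ γ ∧ IsTotallyPositive γ ∧ α = β + γ) := by
  induction h using AddSubmonoid.closure_induction with
  | mem x hx =>
    obtain ⟨β, hβ, hx⟩ := hx
    exact .inr ⟨hx.isIntegral (isIntegral_of_mem_list hρ hβ),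
      hx.isTotallyPositive (isTotallyPositive_of_mem_list hρ hK hβ), .inl ⟨β, hβ, hx⟩⟩
  | zero => exact .inl rfl
  | add x y _ _ hx hy =>
    rcases hx with rfl | ⟨ix, px, hx⟩
    · simpa using hy
    rcases hy with rfl | ⟨iy, py, hy⟩
    · exact .inr ⟨by simpa using ix, by simpa using px, by simpa using hx⟩
    · exact .inr ⟨ix.add iy, px.add py, .inr ⟨x, y, ix, px, iy, py, rfl⟩⟩

theorem IsIndecomposable.exists_mem_list {α : K} (h : IsIndecomposable α) :
    ∃ β ∈ list₁ ρ ∪ list₂ ρ ∪ list₃ ρ, AssociatedByTPUnit α β := by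
  rcases mem_listedMonoid_cases hρ hK (mem_listedMonoid hρ hK h.1 h.2.1) with rfl | ⟨-, -, h' | h'⟩
  · obtain ⟨σ, -⟩ := exists_embeddings hρ hK
    exact absurd (h.2.1 (σ 0)) (by simp)
  · exact h'
  · exact absurd h' h.2.2

theorem one_le_trace {δ α : K} (hδ : δ ∈ codifferent K) (hα : IsIntegral ℤ α)
    (hδ' : IsTotallyPositive δ) (hα' : IsTotallyPositive α) :
    1 ≤ Algebra.trace ℚ K (δ * α) := by
  obtain ⟨n, hn⟩ := exists_int_trace hδ hα
  have := (hδ'.mul hα').trace_pos hρ hK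
  rw [hn] at this ⊢
  exact_mod_cast this

/-- An element on which some totally positive element of the codifferent takes the value `1` has
minimal trace `1` and is indecomposable. -/
theorem hasMinimalTrace_one {α δ : K} (hα : IsIntegral ℤ α) (hα' : IsTotallyPositive α)
    (hδ : δ ∈ codifferent K) (hδ' : IsTotallyPositive δ) (h : Algebra.trace ℚ K (δ * α) = 1) :
    HasMinimalTrace α 1 ∧ IsIndecomposable α := by
  refine ⟨⟨⟨δ, hδ, hδ', by simp [h]⟩, ?_⟩, hα, hα', ?_⟩
  · rintro t ⟨ε, hε, hε', rfl⟩
    simpa using one_le_trace hρ hK hε hα hε' hα'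
  · rintro ⟨β, γ, hβ, hβ', hγ, hγ', rfl⟩
    have h1 := one_le_trace hρ hK hδ hβ hδ' hβ'
    have h2 := one_le_trace hρ hK hδ hγ hδ' hγ'
    rw [mul_add, map_add] at h
    linarith

theorem list₁_properties {α : K} (h : α ∈ list₁ ρ) :
    HasMinimalTrace α 1 ∧ IsIndecomposable α := by
  have hi := isIntegral_of_mem_list hρ (.inl (.inl h))
  have hp := isTotallyPositive_of_mem_list hρ hK (.inl (.inl h))
  obtain ⟨δ₀, c₀, p₀, h₀⟩ :=
    isDualForm_of_mem hρ hK (l := 7) (m := 0) (n := 5) (by decide)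
  obtain ⟨δ₁, c₁, p₁, h₁⟩ :=
    isDualForm_of_mem hρ hK (l := 87) (m := (-2)) (n := 49) (by decide)
  obtain ⟨δ₂, c₂, p₂, h₂⟩ :=
    isDualForm_of_mem hρ hK (l := 3) (m := 2) (n := 15) (by decide)
  obtain ⟨δ₃, c₃, p₃, h₃⟩ :=
    isDualForm_of_mem hρ hK (l := 1) (m := 0) (n := 1) (by decide)
  rcases h with (((((((rfl | ⟨v, w, -, -, -, -, rfl⟩) | ⟨v, -, -, rfl⟩) | ⟨v, -, -, rfl⟩) |
    ⟨v, -, -, rfl⟩) | ⟨v, -, -, rfl⟩) | ⟨v, -, -, rfl⟩) | ⟨v, -, -, rfl⟩)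
  · refine hasMinimalTrace_one hρ hK hi hp c₃ p₃ ?_
    simpa [elt] using h₃ 1 0 0
  · exact hasMinimalTrace_one hρ hK hi hp c₀ p₀ (by rw [h₀]; push_cast; ring)
  · exact hasMinimalTrace_one hρ hK hi hp c₃ p₃ (by rw [h₃]; push_cast; ring)
  · exact hasMinimalTrace_one hρ hK hi hp c₃ p₃ (by rw [h₃]; push_cast; ring)
  · exact hasMinimalTrace_one hρ hK hi hp c₂ p₂ (by rw [h₂]; push_cast; ring)
  · exact hasMinimalTrace_one hρ hK hi hp c₂ p₂ (by rw [h₂]; push_cast; ring)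
  · exact hasMinimalTrace_one hρ hK hi hp c₁ p₁ (by rw [h₁]; push_cast; ring)
  · exact hasMinimalTrace_one hρ hK hi hp c₁ p₁ (by rw [h₁]; push_cast; ring)

end

/-! ### Triangles of index thirteen: elements of minimal trace two and three -/

section

variable {K : Type*} [Field K] {ρ : K} [NumberField K]
  (hρ : ρ ^ 3 - 41 * ρ ^ 2 - 44 * ρ - 1 = 0)
  (hK : IntermediateField.adjoin ℚ {ρ} = (⊤ : IntermediateField ℚ K))

theorem trace_combination {δ V R d : K} {v r s : ℚ} (hv : Algebra.trace ℚ K (δ * V) = v)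
    (hr : Algebra.trace ℚ K (δ * R) = r) (hs : Algebra.trace ℚ K (δ * d) = s) (p q t : ℤ) :
    Algebra.trace ℚ K (δ * (p • V + q • R + t • d)) = p * v + q * r + t * s := by
  simp only [mul_add, mul_smul_comm, map_add, map_zsmul, hv, hr, hs]
  simp only [zsmul_eq_mul]

/-- There is a totally positive element of the codifferent whose trace pairings with `V`, `R` and
`d` are `v`, `r` and `s`. -/
def HasDualValues (V R d : K) (v r s : ℤ) : Prop :=
  ∃ δ ∈ codifferent K, IsTotallyPositive δ ∧ Algebra.trace ℚ K (δ * V) = v ∧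
    Algebra.trace ℚ K (δ * R) = r ∧ Algebra.trace ℚ K (δ * d) = s

/-- The data of a lattice triangle of index `13` on the boundary of the convex hull of the totally
positive integers: `V, R, d` is a basis of the integers, the vertices are `V`, `2 R - d - V` and
`V - R + 7 d`, and the four forms are those of the three adjacent faces and of one more face
through the vertex `V - R + 7 d`. -/
structure IsInnerTriangle (V R d : K) : Prop where
  exists_coords : ∀ α : K, IsIntegral ℤ α → ∃ p q r : ℤ, α = p • V + q • R + r • d
  isIntegral_V : IsIntegral ℤ V
  isIntegral_R : IsIntegral ℤ R
  isIntegral_d : IsIntegral ℤ d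
  pos_V : IsTotallyPositive V
  pos_C : IsTotallyPositive ((2 : ℤ) • R - d - V)
  pos_W : IsTotallyPositive (V - R + (7 : ℤ) • d)
  form₁ : HasDualValues V R d 3 2 0
  form₂ : HasDualValues V R d 1 2 2
  form₃ : HasDualValues V R d 1 7 1
  form₄ : HasDualValues V R d 2 8 1

namespace IsInnerTriangle

variable {V R d : K}

/-- A totally positive integer has level at least `13` with respect to the triangle, where the level
is the form taking the value `13` at the vertices. This makes points of level at most `25`
indecomposable. -/
theorem isIndecomposable_of_level (hρ : ρ ^ 3 - 41 * ρ ^ 2 - 44 * ρ - 1 = 0)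
    (hK : IntermediateField.adjoin ℚ {ρ} = (⊤ : IntermediateField ℚ K))
    (h : IsInnerTriangle V R d) {p q r : ℤ} (hp : IsTotallyPositive (p • V + q • R + r • d))
    (hlevel : 13 * p + 14 * q + 2 * r ≤ 25) : IsIndecomposable (p • V + q • R + r • d) := by
  obtain ⟨δ₁, c₁, p₁, a₁, b₁, e₁⟩ := h.form₁
  obtain ⟨δ₂, c₂, p₂, a₂, b₂, e₂⟩ := h.form₂
  obtain ⟨δ₃, c₃, p₃, a₃, b₃, e₃⟩ := h.form₃
  obtain ⟨δ₄, c₄, p₄, a₄, b₄, e₄⟩ := h.form₄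
  have t₁ := fun p q t : ℤ => trace_combination a₁ b₁ e₁ p q t
  have t₂ := fun p q t : ℤ => trace_combination a₂ b₂ e₂ p q t
  have t₃ := fun p q t : ℤ => trace_combination a₃ b₃ e₃ p q t
  have t₄ := fun p q t : ℤ => trace_combination a₄ b₄ e₄ p q t
  have hpos : ∀ p q r : ℤ, IsTotallyPositive (p • V + q • R + r • d) →
      0 < 3 * p + 2 * q ∧ 0 < p + 2 * q + 2 * r ∧ 0 < p + 7 * q + r ∧ 0 < 2 * p + 8 * q + r := by
    intro p q r hp
    have q₁ := (p₁.mul hp).trace_pos hρ hK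
    have q₂ := (p₂.mul hp).trace_pos hρ hK
    have q₃ := (p₃.mul hp).trace_pos hρ hK
    have q₄ := (p₄.mul hp).trace_pos hρ hK
    rw [t₁] at q₁
    rw [t₂] at q₂
    rw [t₃] at q₃
    rw [t₄] at q₄
    norm_cast at q₁ q₂ q₃ q₄
    omega
  have i : ∀ p q r : ℤ, IsIntegral ℤ (p • V + q • R + r • d) := fun p q r =>
    ((h.isIntegral_V.smul p).add (h.isIntegral_R.smul q)).add (h.isIntegral_d.smul r)
  refine ⟨i p q r, hp, ?_⟩
  rintro ⟨β, γ, hβ, hβ', hγ, hγ', e⟩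
  obtain ⟨x, y, z, rfl⟩ := h.exists_coords β hβ
  obtain ⟨x', y', z', rfl⟩ := h.exists_coords γ hγ
  have f₁ := congrArg (fun w => Algebra.trace ℚ K (δ₁ * w)) e
  have f₂ := congrArg (fun w => Algebra.trace ℚ K (δ₂ * w)) e
  have f₃ := congrArg (fun w => Algebra.trace ℚ K (δ₃ * w)) e
  simp only [mul_add δ₁ (x • V + y • R + z • d), map_add, t₁] at f₁
  simp only [mul_add δ₂ (x • V + y • R + z • d), map_add, t₂] at f₂
  simp only [mul_add δ₃ (x • V + y • R + z • d), map_add, t₃] at f₃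
  norm_cast at f₁ f₂ f₃
  have hb := hpos _ _ _ hβ'
  have hc := hpos _ _ _ hγ'
  have l1 : 13 ≤ 13 * x + 14 * y + 2 * z := by omega
  have l2 : 13 ≤ 13 * x' + 14 * y' + 2 * z' := by omega
  omega

/-- The values of an element of the codifferent are constrained by their positivity at the three
vertices alone. -/
theorem lower_bound (hρ : ρ ^ 3 - 41 * ρ ^ 2 - 44 * ρ - 1 = 0)
    (hK : IntermediateField.adjoin ℚ {ρ} = (⊤ : IntermediateField ℚ K))
    (h : IsInnerTriangle V R d) {δ : K} (hδ : δ ∈ codifferent K) (hδ' : IsTotallyPositive δ) :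
    ∃ v r s : ℤ, 1 ≤ v ∧ 1 ≤ 2 * r - s - v ∧ 1 ≤ v - r + 7 * s ∧
      ∀ p q t : ℤ,
        Algebra.trace ℚ K (δ * (p • V + q • R + t • d)) = (p * v + q * r + t * s : ℤ) := by
  obtain ⟨v, hv⟩ := exists_int_trace hδ h.isIntegral_V
  obtain ⟨r, hr⟩ := exists_int_trace hδ h.isIntegral_R
  obtain ⟨s, hs⟩ := exists_int_trace hδ h.isIntegral_d
  have htr : ∀ p q t : ℤ, Algebra.trace ℚ K (δ * (p • V + q • R + t • d))
      = (p * v + q * r + t * s : ℤ) := by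
    intro p q t
    rw [trace_combination hv hr hs]
    push_cast
    ring
  refine ⟨v, r, s, ?_, ?_, ?_, htr⟩
  · have := (hδ'.mul h.pos_V).trace_pos hρ hK
    rw [hv] at this
    norm_cast at this
  · have := (hδ'.mul h.pos_C).trace_pos hρ hK
    rw [show (2 : ℤ) • R - d - V = (-1 : ℤ) • V + (2 : ℤ) • R + (-1 : ℤ) • d by module, htr] at this
    norm_cast at this
    omega
  · have := (hδ'.mul h.pos_W).trace_pos hρ hK
    rw [show V - R + (7 : ℤ) • d = (1 : ℤ) • V + (-1 : ℤ) • R + (7 : ℤ) • d by module, htr] at this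
    norm_cast at this
    omega

/-- The points `R + j d` have level `14 + 2 j`. -/
theorem row_properties (hρ : ρ ^ 3 - 41 * ρ ^ 2 - 44 * ρ - 1 = 0)
    (hK : IntermediateField.adjoin ℚ {ρ} = (⊤ : IntermediateField ℚ K))
    (h : IsInnerTriangle V R d) {α : K} (hα : IsTotallyPositive α) (j : ℤ) (h0 : 0 ≤ j)
    (h5 : j ≤ 5) (e : α = (0 : ℤ) • V + (1 : ℤ) • R + j • d) :
    HasMinimalTrace α 2 ∧ IsIndecomposable α := by
  subst e
  refine ⟨⟨?_, ?_⟩, h.isIndecomposable_of_level hρ hK hα (by omega)⟩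
  · obtain ⟨δ, c, p, a, b, e⟩ := h.form₁
    exact ⟨δ, c, p, by rw [trace_combination a b e]; norm_num⟩
  · rintro t ⟨δ, hδ, hδ', rfl⟩
    obtain ⟨v, r, s, hv, hC, hW, htr⟩ := h.lower_bound hρ hK hδ hδ'
    rw [htr]
    have : 2 ≤ 0 * v + 1 * r + j * s := by
      interval_cases j <;> omega
    exact_mod_cast this

/-- The point `V + d` has level `15`. -/
theorem neighbour_properties (hρ : ρ ^ 3 - 41 * ρ ^ 2 - 44 * ρ - 1 = 0)
    (hK : IntermediateField.adjoin ℚ {ρ} = (⊤ : IntermediateField ℚ K))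
    (h : IsInnerTriangle V R d) {α : K} (hα : IsTotallyPositive α)
    (e : α = (1 : ℤ) • V + (0 : ℤ) • R + (1 : ℤ) • d) :
    HasMinimalTrace α 2 ∧ IsIndecomposable α := by
  subst e
  refine ⟨⟨?_, ?_⟩, h.isIndecomposable_of_level hρ hK hα (by omega)⟩
  · obtain ⟨δ, c, p, a, b, e⟩ := h.form₃
    exact ⟨δ, c, p, by rw [trace_combination a b e]; norm_num⟩
  · rintro t ⟨δ, hδ, hδ', rfl⟩
    obtain ⟨v, r, s, hv, hC, hW, htr⟩ := h.lower_bound hρ hK hδ hδ'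
    rw [htr]
    have : 2 ≤ 1 * v + 0 * r + 1 * s := by omega
    exact_mod_cast this

/-- The points `V + j d` with `2 ≤ j` have level `13 + 2 j`. -/
theorem farRow_properties (hρ : ρ ^ 3 - 41 * ρ ^ 2 - 44 * ρ - 1 = 0)
    (hK : IntermediateField.adjoin ℚ {ρ} = (⊤ : IntermediateField ℚ K))
    (h : IsInnerTriangle V R d) {α : K} (hα : IsTotallyPositive α) (j : ℤ) (h2 : 2 ≤ j)
    (h6 : j ≤ 6) (e : α = (1 : ℤ) • V + (0 : ℤ) • R + j • d) :
    HasMinimalTrace α 3 ∧ IsIndecomposable α := by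
  subst e
  refine ⟨⟨?_, ?_⟩, h.isIndecomposable_of_level hρ hK hα (by omega)⟩
  · obtain ⟨δ, c, p, a, b, e⟩ := h.form₁
    exact ⟨δ, c, p, by rw [trace_combination a b e]; norm_num⟩
  · rintro t ⟨δ, hδ, hδ', rfl⟩
    obtain ⟨v, r, s, hv, hC, hW, htr⟩ := h.lower_bound hρ hK hδ hδ'
    rw [htr]
    have : 3 ≤ 1 * v + 0 * r + j * s := by
      interval_cases j <;> omega
    exact_mod_cast this

end IsInnerTriangle

theorem IsDualForm.hasDualValues {l m n : ℤ} (h : IsDualForm ρ l m n)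
    {x y z x' y' z' x'' y'' z'' v r s : ℤ} (hv : l * x + m * y + n * z = v)
    (hr : l * x' + m * y' + n * z' = r) (hs : l * x'' + m * y'' + n * z'' = s) :
    HasDualValues (elt ρ x y z) (elt ρ x' y' z') (elt ρ x'' y'' z'') v r s := by
  obtain ⟨δ, c, p, e⟩ := h
  exact ⟨δ, c, p, by rw [e, hv], by rw [e, hr], by rw [e, hs]⟩

include hρ hK

theorem isInnerTriangle_A :
    IsInnerTriangle (elt ρ (-4) (-3) 7) (elt ρ (-3) (-9) 5) (elt ρ 0 (-1) 0) where
  exists_coords α hα := by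
    obtain ⟨x, y, z, rfl⟩ := (isIntegral_iff_exists_elt hρ hK).1 hα
    refine ⟨5 * x + 3 * z, -7 * x - 4 * z, 48 * x - y + 27 * z, ?_⟩
    simp only [zsmul_elt, elt_add]
    exact elt_congr (by ring) (by ring) (by ring)
  isIntegral_V := isIntegral_elt hρ _ _ _
  isIntegral_R := isIntegral_elt hρ _ _ _
  isIntegral_d := isIntegral_elt hρ _ _ _
  pos_V := (isTotallyPositive_elt_iff hρ hK _ _ _).2 (by decide)
  pos_C := by
    simp only [zsmul_elt, elt_sub]
    exact (isTotallyPositive_elt_iff hρ hK _ _ _).2 (by decide)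
  pos_W := by
    simp only [zsmul_elt, elt_sub, elt_add]
    exact (isTotallyPositive_elt_iff hρ hK _ _ _).2 (by decide)
  form₁ := (isDualForm_of_mem hρ hK (l := 1) (m := 0) (n := 1)
    (by decide)).hasDualValues (by norm_num) (by norm_num) (by norm_num)
  form₂ := (isDualForm_of_mem hρ hK (l := 87) (m := (-2)) (n := 49)
    (by decide)).hasDualValues (by norm_num) (by norm_num) (by norm_num)
  form₃ := (isDualForm_of_mem hρ hK (l := 4) (m := (-1)) (n := 2)
    (by decide)).hasDualValues (by norm_num) (by norm_num) (by norm_num)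
  form₄ := (isDualForm_of_mem hρ hK (l := 2) (m := (-1)) (n := 1)
    (by decide)).hasDualValues (by norm_num) (by norm_num) (by norm_num)

theorem isInnerTriangle_B :
    IsInnerTriangle (elt ρ 1 0 0) (elt ρ (-3) (-32) 5) (elt ρ (-5) (-45) 7) where
  exists_coords α hα := by
    obtain ⟨x, y, z, rfl⟩ := (isIntegral_iff_exists_elt hρ hK).1 hα
    refine ⟨x - 4 * y - 25 * z, 7 * y + 45 * z, -5 * y - 32 * z, ?_⟩
    simp only [zsmul_elt, elt_add]
    exact elt_congr (by ring) (by ring) (by ring)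
  isIntegral_V := isIntegral_elt hρ _ _ _
  isIntegral_R := isIntegral_elt hρ _ _ _
  isIntegral_d := isIntegral_elt hρ _ _ _
  pos_V := (isTotallyPositive_elt_iff hρ hK _ _ _).2 (by decide)
  pos_C := by
    simp only [zsmul_elt, elt_sub]
    exact (isTotallyPositive_elt_iff hρ hK _ _ _).2 (by decide)
  pos_W := by
    simp only [zsmul_elt, elt_sub, elt_add]
    exact (isTotallyPositive_elt_iff hρ hK _ _ _).2 (by decide)
  form₁ := (isDualForm_of_mem hρ hK (l := 3) (m := 2) (n := 15)
    (by decide)).hasDualValues (by norm_num) (by norm_num) (by norm_num)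
  form₂ := (isDualForm_of_mem hρ hK (l := 1) (m := 0) (n := 1)
    (by decide)).hasDualValues (by norm_num) (by norm_num) (by norm_num)
  form₃ := (isDualForm_of_mem hρ hK (l := 1) (m := 40) (n := 258)
    (by decide)).hasDualValues (by norm_num) (by norm_num) (by norm_num)
  form₄ := (isDualForm_of_mem hρ hK (l := 2) (m := 43) (n := 278)
    (by decide)).hasDualValues (by norm_num) (by norm_num) (by norm_num)

theorem isInnerTriangle_C :
    IsInnerTriangle (elt ρ (-214) (-1936) 301) (elt ρ (-118) (-1067) 166) (elt ρ 5 46 (-7)) where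
  exists_coords α hα := by
    obtain ⟨x, y, z, rfl⟩ := (isIntegral_iff_exists_elt hρ hK).1 hα
    refine ⟨-167 * x + 4 * y - 93 * z, 294 * x - 7 * y + 164 * z, -209 * x + 6 * y - 110 * z, ?_⟩
    simp only [zsmul_elt, elt_add]
    exact elt_congr (by ring) (by ring) (by ring)
  isIntegral_V := isIntegral_elt hρ _ _ _
  isIntegral_R := isIntegral_elt hρ _ _ _
  isIntegral_d := isIntegral_elt hρ _ _ _
  pos_V := (isTotallyPositive_elt_iff hρ hK _ _ _).2 (by decide)
  pos_C := by
    simp only [zsmul_elt, elt_sub]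
    exact (isTotallyPositive_elt_iff hρ hK _ _ _).2 (by decide)
  pos_W := by
    simp only [zsmul_elt, elt_sub, elt_add]
    exact (isTotallyPositive_elt_iff hρ hK _ _ _).2 (by decide)
  form₁ := (isDualForm_of_mem hρ hK (l := 87) (m := (-2)) (n := 49)
    (by decide)).hasDualValues (by norm_num) (by norm_num) (by norm_num)
  form₂ := (isDualForm_of_mem hρ hK (l := 3) (m := 2) (n := 15)
    (by decide)).hasDualValues (by norm_num) (by norm_num) (by norm_num)
  form₃ := (isDualForm_of_mem hρ hK (l := 1682) (m := (-39)) (n := 945)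
    (by decide)).hasDualValues (by norm_num) (by norm_num) (by norm_num)
  form₄ := (isDualForm_of_mem hρ hK (l := 1809) (m := (-42)) (n := 1016)
    (by decide)).hasDualValues (by norm_num) (by norm_num) (by norm_num)

theorem list₂_properties {α : K} (h : α ∈ list₂ ρ) :
    HasMinimalTrace α 2 ∧ IsIndecomposable α := by
  have hp := isTotallyPositive_of_mem_list hρ hK (.inl (.inr h))
  rcases h with (((⟨v, h1, h2, rfl⟩ | ⟨v, h1, h2, rfl⟩) | ⟨v, h1, h2, rfl⟩) | (rfl | rfl | rfl))
  · refine (isInnerTriangle_A hρ hK).row_properties hρ hK hp (v - 9) (by omega) (by omega) ?_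
    simp only [zsmul_elt, elt_add]
    exact elt_congr (by ring) (by ring) (by ring)
  · refine (isInnerTriangle_B hρ hK).row_properties hρ hK hp v h1 h2 ?_
    simp only [zsmul_elt, elt_add]
    exact elt_congr (by ring) (by ring) (by ring)
  · refine (isInnerTriangle_C hρ hK).row_properties hρ hK hp (5 - v) (by omega) (by omega) ?_
    simp only [zsmul_elt, elt_add]
    exact elt_congr (by ring) (by ring) (by ring)
  · refine (isInnerTriangle_A hρ hK).neighbour_properties hρ hK hp ?_
    simp only [zsmul_elt, elt_add]
    exact elt_congr (by ring) (by ring) (by ring)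
  · refine (isInnerTriangle_B hρ hK).neighbour_properties hρ hK hp ?_
    simp only [zsmul_elt, elt_add]
    exact elt_congr (by ring) (by ring) (by ring)
  · refine (isInnerTriangle_C hρ hK).neighbour_properties hρ hK hp ?_
    simp only [zsmul_elt, elt_add]
    exact elt_congr (by ring) (by ring) (by ring)

theorem list₃_properties {α : K} (h : α ∈ list₃ ρ) :
    HasMinimalTrace α 3 ∧ IsIndecomposable α := by
  have hp := isTotallyPositive_of_mem_list hρ hK (.inr h)
  rcases h with ((⟨v, h1, h2, rfl⟩ | ⟨v, h1, h2, rfl⟩) | ⟨v, h1, h2, rfl⟩)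
  · refine (isInnerTriangle_A hρ hK).farRow_properties hρ hK hp (v - 3) (by omega) (by omega) ?_
    simp only [zsmul_elt, elt_add]
    exact elt_congr (by ring) (by ring) (by ring)
  · refine (isInnerTriangle_B hρ hK).farRow_properties hρ hK hp (v + 1) (by omega) (by omega) ?_
    simp only [zsmul_elt, elt_add]
    exact elt_congr (by ring) (by ring) (by ring)
  · refine (isInnerTriangle_C hρ hK).farRow_properties hρ hK hp (6 - v) (by omega) (by omega) ?_
    simp only [zsmul_elt, elt_add]
    exact elt_congr (by ring) (by ring) (by ring)

end

end SimplestCubic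

end

theorem mainTheorem7 {K : Type*} [Field K] [NumberField K] (ρ : K)
    (hρ : ρ ^ 3 - 41 * ρ ^ 2 - 44 * ρ - 1 = 0)
    (hK : IntermediateField.adjoin ℚ {ρ} = (⊤ : IntermediateField ℚ K)) :
    -- `1, ρ, g₃` is an integral basis
    (∃ b : Module.Basis (Fin 3) ℤ (𝓞 K),
      (b 0 : K) = 1 ∧ (b 1 : K) = ρ ∧ (b 2 : K) = SimplestCubic.g₃ ρ) ∧
    -- up to totally positive units, the indecomposables are exactly the listed elements
    (∀ α : K, SimplestCubic.IsIndecomposable α ↔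
      ∃ β ∈ SimplestCubic.list₁ ρ ∪ SimplestCubic.list₂ ρ ∪ SimplestCubic.list₃ ρ,
        SimplestCubic.AssociatedByTPUnit α β) ∧
    -- no two distinct listed elements agree up to a totally positive unit
    (SimplestCubic.list₁ ρ ∪ SimplestCubic.list₂ ρ ∪ SimplestCubic.list₃ ρ).Pairwise
      (fun α β => ¬ SimplestCubic.AssociatedByTPUnit α β) ∧
    -- minimal traces
    (∀ α ∈ SimplestCubic.list₁ ρ, SimplestCubic.HasMinimalTrace α 1) ∧
    (∀ α ∈ SimplestCubic.list₂ ρ, SimplestCubic.HasMinimalTrace α 2) ∧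
    (∀ α ∈ SimplestCubic.list₃ ρ, SimplestCubic.HasMinimalTrace α 3) := by
  refine ⟨SimplestCubic.exists_integralBasis hρ hK, fun α => ⟨fun h => h.exists_mem_list hρ hK, ?_⟩,
    SimplestCubic.list_pairwise hρ hK, fun α h => (SimplestCubic.list₁_properties hρ hK h).1,
    fun α h => (SimplestCubic.list₂_properties hρ hK h).1,
    fun α h => (SimplestCubic.list₃_properties hρ hK h).1⟩
  rintro ⟨β, (hβ | hβ) | hβ, h⟩
  · exact h.isIndecomposable (SimplestCubic.list₁_properties hρ hK hβ).2
  · exact h.isIndecomposable (SimplestCubic.list₂_properties hρ hK hβ).2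
  · exact h.isIndecomposable (SimplestCubic.list₃_properties hρ hK hβ).2
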